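/- Let $d\ge 1$ and let $m$ be a positive integer with $m>d/2$. Let $\Omega\subset\mathbb{R}^d$ be a domain (an open set) with Lipschitz boundary and of finite width, i.e. lying between two parallel hyperplanes. Let $k(x,y)=\kappa(x-y)$ be a symmetric positive-definite translation-invariant kernel on $\mathbb{R}^d$ with $\kappa\in L_1(\mathbb{R}^d)$, whose Fourier transform $\hat\kappa(\xi)=(2\pi)^{-d/2}\int_{\mathbb{R}^d}\kappa(x)e^{-i\langle x,\xi\rangle}\,dx$ decays at rate $m$: for some constants $0<c_1\le c_2$, $$c_1(1+\|\xi\|_2^2)^{-m}\le\hat\kappa(\xi)\le c_2(1+\|\xi\|_2^2)^{-m}\quad\text{for all }\xi\in\mathbb{R}^d.$$ Let $W^{m,2}(\Omega)$ be the space of $f\in L_2(\Omega)$ whose weak derivatives $D^{\alpha}f$, $|\alpha|\le m$, all lie in $L_2(\Omega)$, with norm $\|f\|_{m,2}=\big(\sum_{|\alpha|\le m}\int_\Omega|D^\alpha f|^2\big)^{1/2}$ and seminorm $|f|_{m,2}=\big(\sum_{|\alpha|=m}\int_\Omega|D^\alpha f|^2\big)^{1/2}$, and let $W^{m,2}_0(\Omega)$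 be the closure of $C_0^\infty(\Omega)$ in $W^{m,2}(\Omega)$. Let $\mathcal{H}_k(\Omega)$ be the reproducing kernel Hilbert space of the restriction of $k$ to $\Omega\times\Omega$. Then there are constants $0<c_l<c_u$ such that every $f\in W_0^{m,2}(\Omega)$ has a continuous representative on $\Omega$ that belongs to $\mathcal{H}_k(\Omega)$, and this representative satisfies $$c_l\,|f|_{m,2}\le\|f\|_{\mathcal{H}_k(\Omega)}\le c_u\,|f|_{m,2}.$$ -/

import Mathlib

open MeasureTheory
open scoped ContDiff InnerProductSpace

noncomputable section

/-- The Euclidean space `ℝ^d`. -/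
abbrev Rn (d : ℕ) : Type := EuclideanSpace ℝ (Fin d)

/-! ## Multi-indices, weak derivatives and Sobolev spaces -/

/-- The classical partial derivative `∂g/∂x_i`. -/
def partialDeriv {d : ℕ} (i : Fin d) (g : Rn d → ℝ) : Rn d → ℝ :=
  fun x => fderiv ℝ g x (EuclideanSpace.single i 1)

/-- The classical mixed derivative `∂_1^{α_1} ⋯ ∂_d^{α_d} g` (used for smooth `g` only). -/
def multiDeriv {d : ℕ} (α : Fin d → ℕ) (g : Rn d → ℝ) : Rn d → ℝ :=
  (List.finRange d).foldr (fun i h => (partialDeriv i)^[α i] h) g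

/-- `φ ∈ C_0^∞(Ω)`: smooth, with compact support contained in `Ω`. -/
structure IsTestFunction {d : ℕ} (Ω : Set (Rn d)) (φ : Rn d → ℝ) : Prop where
  smooth : ContDiff ℝ ∞ φ
  compact_support : HasCompactSupport φ
  support_subset : tsupport φ ⊆ Ω

/-- `g` is the weak derivative `D^α f` on the open set `Ω`. -/
structure HasWeakDeriv {d : ℕ} (Ω : Set (Rn d)) (α : Fin d → ℕ) (f g : Rn d → ℝ) : Prop where
  locallyIntegrable_left : LocallyIntegrableOn f Ω
  locallyIntegrable_right : LocallyIntegrableOn g Ω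
  integral_eq : ∀ φ : Rn d → ℝ, IsTestFunction Ω φ →
    ∫ x in Ω, f x * multiDeriv α φ x = (-1) ^ (∑ i, α i) * ∫ x in Ω, g x * φ x

open Classical in
/-- A representative of the weak derivative `D^α f` on `Ω`, which is unique up to a null set
(and `0` if there is no weak derivative). -/
def weakDeriv {d : ℕ} (Ω : Set (Rn d)) (α : Fin d → ℕ) (f : Rn d → ℝ) : Rn d → ℝ :=
  if h : ∃ g, HasWeakDeriv Ω α f g then h.choose else 0

/-- `f ∈ W^{m,2}(Ω)`. Functions are only looked at on `Ω`, up to null sets. -/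
def MemSobolev {d : ℕ} (Ω : Set (Rn d)) (m : ℕ) (f : Rn d → ℝ) : Prop :=
  MemLp f 2 (volume.restrict Ω) ∧
    ∀ α : Fin d → ℕ, ∑ i, α i ≤ m →
      ∃ g, HasWeakDeriv Ω α f g ∧ MemLp g 2 (volume.restrict Ω)

/-- The `j`-th order seminorm `|f|_{j,2,Ω} = (∑_{|α| = j} ∫_Ω |D^α f|²)^{1/2}`. -/
def sobolevSeminorm {d : ℕ} (Ω : Set (Rn d)) (j : ℕ) (f : Rn d → ℝ) : ℝ :=
  Real.sqrt (∑ α ∈ Finset.piAntidiag Finset.univ j, ∫ x in Ω, (weakDeriv Ω α f x) ^ 2)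

/-- The norm `‖f‖_{m,2,Ω} = (∑_{|α| ≤ m} ∫_Ω |D^α f|²)^{1/2}`. -/
def sobolevNorm {d : ℕ} (Ω : Set (Rn d)) (m : ℕ) (f : Rn d → ℝ) : ℝ :=
  Real.sqrt (∑ j ∈ Finset.range (m + 1),
    ∑ α ∈ Finset.piAntidiag Finset.univ j, ∫ x in Ω, (weakDeriv Ω α f x) ^ 2)

/-- `f ∈ W_0^{m,2}(Ω)`, the closure of `C_0^∞(Ω)` in `W^{m,2}(Ω)`. -/
def MemSobolevZero {d : ℕ} (Ω : Set (Rn d)) (m : ℕ) (f : Rn d → ℝ) : Prop :=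
  MemSobolev Ω m f ∧
    ∀ ε : ℝ, 0 < ε → ∃ φ : Rn d → ℝ, IsTestFunction Ω φ ∧ sobolevNorm Ω m (f - φ) < ε

/-! ## Domains -/

/-- `Ω` has finite width: it lies between two parallel hyperplanes. -/
def HasFiniteWidth {d : ℕ} (Ω : Set (Rn d)) : Prop :=
  ∃ v : Rn d, v ≠ 0 ∧ ∃ a b : ℝ, ∀ x ∈ Ω, a ≤ inner ℝ v x ∧ inner ℝ v x ≤ b

/-- `Ω` has a Lipschitz boundary: near each boundary point, `Ω` is the set of points strictly above
the graph of a Lipschitz function, with respect to some direction `v` taken as vertical. -/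
def HasLipschitzBoundary {d : ℕ} (Ω : Set (Rn d)) : Prop :=
  ∀ x₀ ∈ frontier Ω, ∃ v : Rn d, ‖v‖ = 1 ∧ ∃ r : ℝ, 0 < r ∧
    ∃ (L : NNReal) (γ : (Submodule.span ℝ {v})ᗮ → ℝ), LipschitzWith L γ ∧
      ∀ x ∈ Metric.ball x₀ r,
        (x ∈ Ω ↔ γ ((Submodule.span ℝ {v})ᗮ.orthogonalProjectionOnto x) < inner ℝ v x)

/-! ## Kernels and their reproducing kernel Hilbert spaces -/

/-- The translation-invariant kernel `k(x, y) = κ(x - y)`. -/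
def translationKernel {d : ℕ} (κ : Rn d → ℝ) : Rn d → Rn d → ℝ := fun x y => κ (x - y)

/-- `k` is a symmetric positive (semi)definite kernel: all its Gram matrices are. -/
class IsPosDefKernel {X : Type*} (k : X → X → ℝ) : Prop where
  symm : ∀ x y, k x y = k y x
  nonneg : ∀ (s : Finset X) (c : X → ℝ), 0 ≤ ∑ x ∈ s, ∑ y ∈ s, c x * c y * k x y

/-- The restriction of the scalar kernel `k` to `Ω × Ω`, in the operator-valued form which
Mathlib's reproducing kernel Hilbert spaces use. -/
def kernelMatrix {X : Type*} (k : X → X → ℝ) (Ω : Set X) : Matrix Ω Ω (ℝ →L[ℝ] ℝ) :=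
  Matrix.of fun x y => k x y • ContinuousLinearMap.id ℝ ℝ

theorem kernelMatrix_posSemidef {X : Type*} (k : X → X → ℝ) [hk : IsPosDefKernel k]
    (Ω : Set X) : (kernelMatrix k Ω).PosSemidef := by
  classical
  have key : (kernelMatrix k Ω).PosSemidef ↔ (kernelMatrix k Ω).IsHermitian ∧ ∀ vv : Ω →₀ ℝ,
      0 ≤ RCLike.re (vv.sum fun x w => vv.sum fun x' w' => ⟪kernelMatrix k Ω x' x w, w'⟫_ℝ) :=
    (RKHS.posSemidef_tfae (K := kernelMatrix k Ω)).out 0 2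
  refine key.mpr ⟨?_, ?_⟩
  · have hid : star (ContinuousLinearMap.id ℝ ℝ) = ContinuousLinearMap.id ℝ ℝ :=
      star_one (ℝ →L[ℝ] ℝ)
    ext x y
    simp [kernelMatrix, hk.symm (x : X) y, hid]
  · intro vv
    let c : X → ℝ := fun x => if h : x ∈ Ω then vv ⟨x, h⟩ else 0
    have h := hk.nonneg (vv.support.map (Function.Embedding.subtype _)) c
    simp only [Finset.sum_map] at h
    simp only [Finsupp.sum, RCLike.re_to_real]
    refine h.trans_eq (Finset.sum_congr rfl fun x _ => Finset.sum_congr rfl fun y _ => ?_)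
    simp [c, kernelMatrix, hk.symm (x : X) y]
    ring

instance kernelMatrix_fact {X : Type*} (k : X → X → ℝ) [IsPosDefKernel k] (Ω : Set X) :
    Fact (kernelMatrix k Ω).PosSemidef := ⟨kernelMatrix_posSemidef k Ω⟩

/-- `H_k(Ω)`, the reproducing kernel Hilbert space of (the restriction to `Ω` of) the kernel `k`.
Its elements coerce to functions `Ω → ℝ`. -/
abbrev RKHSOn {X : Type*} (k : X → X → ℝ) [IsPosDefKernel k] (Ω : Set X) : Type _ :=
  RKHS.OfKernel (kernelMatrix k Ω)

/-- The Fourier transform `ĝ(ξ) = (2π)^{-d/2} ∫ g(x) e^{-i⟨x, ξ⟩} dx`. -/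
def fourierHat {d : ℕ} (g : Rn d → ℝ) (ξ : Rn d) : ℂ :=
  (((2 * Real.pi) ^ (-(d : ℝ) / 2) : ℝ) : ℂ) *
    ∫ x : Rn d, (g x : ℂ) * Complex.exp (-(Complex.I * ((inner ℝ x ξ : ℝ) : ℂ)))

/-- The Fourier transform of `κ` is real and decays at rate `s`:
`c₁ (1 + ‖ξ‖²)^{-s} ≤ κ̂(ξ) ≤ c₂ (1 + ‖ξ‖²)^{-s}` for all `ξ`. -/
def HasFourierDecay {d : ℕ} (κ : Rn d → ℝ) (s : ℕ) : Prop :=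
  ∃ c₁ c₂ : ℝ, 0 < c₁ ∧ c₁ ≤ c₂ ∧ ∀ ξ : Rn d,
    (fourierHat κ ξ).im = 0 ∧
    c₁ * ((1 + ‖ξ‖ ^ 2) ^ s)⁻¹ ≤ (fourierHat κ ξ).re ∧
    (fourierHat κ ξ).re ≤ c₂ * ((1 + ‖ξ‖ ^ 2) ^ s)⁻¹

end

/-! Both inequalities are proved for test functions on the Fourier side and then passed to the
closure. With frequencies scaled by 2π, let `w = (1 + ‖2πξ‖²)^{-m}`, so that `κ̂` is comparable to
`w`, and let `P` be the symbol of the squared seminorm, so that `|φ|² = ∫ P |φ̂|²` by Plancherel. By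
the multinomial theorem `P` is comparable to `‖2πξ‖^{2m}`. Finite width gives Poincaré's inequality,
hence `∫ w⁻¹ |φ̂|² ≤ C |φ|²`.

Upper bound. By Fourier inversion `∑ c_i φ(x_i) = ∫ S φ̂`, where `S` is the exponential sum of the
points. Cauchy–Schwarz with weight `w` bounds its square by `∫ w |S|² · ∫ w⁻¹ |φ̂|²`, and `∫ w |S|²`
is at most a constant times the quadratic form of the kernel. By Riesz representation such a bound
puts `φ` in the Hilbert space (`FourierBounds.sq_sum_mul_le`, `exists_coe_eq_of_sq_sum_le`).

Lower bound, by duality and without extending functions beyond `Ω`. If `u` restricts `φ`, then `(∫ φ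
g)² ≤ ‖u‖² ∫ κ̂ |ĝ|²` for every test function `g` on `Ω` (`FourierBounds.sq_integral_mul_le`). For
`g` with `ĝ = ± P φ̂`, the left side is `|φ|⁴`, and `w P ≤ 1` bounds the last integral by `c₂ |φ|²`.

The kernel is not assumed continuous: it agrees with the inverse transform of `κ̂` only almost
everywhere. Hence the form of `κ` is only shown to dominate that of the continuous version, which is
what the upper bound needs, and the lower bound replaces point evaluations by averages over random
points. -/

open scoped FourierTransform LineDeriv SchwartzMap
open Filter Topology

/-! ### Test functions and their Fourier transforms -/

/-- The Fourier transform of a real-valued function, in Mathlib's normalisation. -/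
noncomputable def realFourier {d : ℕ} (φ : Rn d → ℝ) : Rn d → ℂ := 𝓕 (fun x => (φ x : ℂ))

/-- The directional derivative `∂_v g`. -/
noncomputable def dirDeriv {d : ℕ} (v : Rn d) (g : Rn d → ℝ) : Rn d → ℝ := fun x => fderiv ℝ g x v

theorem tsupport_dirDeriv_subset {d : ℕ} (v : Rn d) (g : Rn d → ℝ) :
    tsupport (dirDeriv v g) ⊆ tsupport g :=
  (closure_mono fun x hx => by
    simp only [Function.mem_support, dirDeriv] at hx ⊢
    exact fun h0 => hx (by rw [h0]; rfl)).trans (tsupport_fderiv_subset ℝ (f := g))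

namespace IsTestFunction

variable {d : ℕ} {Ω : Set (Rn d)} {φ ψ : Rn d → ℝ}

/-- A test function as a complex-valued Schwartz function. -/
noncomputable def toSchwartz (h : IsTestFunction Ω φ) : 𝓢(Rn d, ℂ) :=
  (h.compact_support.comp_left (g := Complex.ofReal) rfl).toSchwartzMap
    (Complex.ofRealCLM.contDiff.comp h.smooth)

@[simp] theorem toSchwartz_apply (h : IsTestFunction Ω φ) (x : Rn d) :
    h.toSchwartz x = φ x := rfl

theorem fourier_toSchwartz (h : IsTestFunction Ω φ) (ξ : Rn d) :
    𝓕 h.toSchwartz ξ = realFourier φ ξ := rfl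

theorem continuous (h : IsTestFunction Ω φ) : Continuous φ := h.smooth.continuous

theorem integrable (h : IsTestFunction Ω φ) : Integrable φ :=
  h.continuous.integrable_of_hasCompactSupport h.compact_support

theorem mul_integrable (hφ : IsTestFunction Ω φ) (hψ : Continuous ψ) :
    Integrable fun x => φ x * ψ x :=
  (hφ.continuous.mul hψ).integrable_of_hasCompactSupport hφ.compact_support.mul_right

theorem sq_integrable (h : IsTestFunction Ω φ) : Integrable fun x => φ x ^ 2 := by
  simpa only [sq] using h.mul_integrable h.continuous

theorem eq_zero_of_notMem (h : IsTestFunction Ω φ) {x : Rn d} (hx : x ∉ Ω) : φ x = 0 :=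
  image_eq_zero_of_notMem_tsupport fun h' => hx (h.support_subset h')

theorem dirDeriv (h : IsTestFunction Ω φ) (v : Rn d) : IsTestFunction Ω (dirDeriv v φ) where
  smooth := (h.smooth.fderiv_right (m := ∞) le_rfl).clm_apply contDiff_const
  compact_support := h.compact_support.mono' ((subset_tsupport _).trans
    (tsupport_dirDeriv_subset v φ))
  support_subset := (tsupport_dirDeriv_subset v φ).trans h.support_subset

theorem partialDeriv (h : IsTestFunction Ω φ) (i : Fin d) :
    IsTestFunction Ω (partialDeriv i φ) := h.dirDeriv _

theorem iterate_partialDeriv (h : IsTestFunction Ω φ) (i : Fin d) (n : ℕ) :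
    IsTestFunction Ω ((_root_.partialDeriv i)^[n] φ) := by
  induction n with
  | zero => exact h
  | succ n ih => rw [Function.iterate_succ_apply']; exact ih.partialDeriv i

theorem iterate_dirDeriv (h : IsTestFunction Ω φ) (v : Rn d) (n : ℕ) :
    IsTestFunction Ω ((_root_.dirDeriv v)^[n] φ) := by
  induction n with
  | zero => exact h
  | succ n ih => rw [Function.iterate_succ_apply']; exact ih.dirDeriv v

theorem foldr_partialDeriv (h : IsTestFunction Ω φ) (α : Fin d → ℕ) (l : List (Fin d)) :
    IsTestFunction Ω (l.foldr (fun i h => (_root_.partialDeriv i)^[α i] h) φ) := by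
  induction l with
  | nil => exact h
  | cons i l ih => exact ih.iterate_partialDeriv i _

theorem multiDeriv (h : IsTestFunction Ω φ) (α : Fin d → ℕ) :
    IsTestFunction Ω (multiDeriv α φ) := h.foldr_partialDeriv α _

theorem add (h : IsTestFunction Ω φ) (h' : IsTestFunction Ω ψ) :
    IsTestFunction Ω (fun x => φ x + ψ x) where
  smooth := h.smooth.add h'.smooth
  compact_support := h.compact_support.add h'.compact_support
  support_subset := (tsupport_add φ ψ).trans (Set.union_subset h.support_subset h'.support_subset)

theorem sub (h : IsTestFunction Ω φ) (h' : IsTestFunction Ω ψ) :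
    IsTestFunction Ω (fun x => φ x - ψ x) where
  smooth := h.smooth.sub h'.smooth
  compact_support := h.compact_support.sub h'.compact_support
  support_subset := (tsupport_sub φ ψ).trans (Set.union_subset h.support_subset h'.support_subset)

theorem fourier_dirDeriv (h : IsTestFunction Ω φ) (v ξ : Rn d) :
    realFourier (_root_.dirDeriv v φ) ξ
      = (2 * Real.pi * Complex.I * (inner ℝ ξ v : ℝ)) * realFourier φ ξ := by
  have h1 : (h.dirDeriv v).toSchwartz = ∂_{v} h.toSchwartz := by
    ext x
    rw [SchwartzMap.lineDerivOp_apply_eq_fderiv, toSchwartz_apply]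
    have h2 : HasFDerivAt (fun x => (φ x : ℂ)) (Complex.ofRealCLM ∘L fderiv ℝ φ x) x :=
      Complex.ofRealCLM.hasFDerivAt.comp x
        (h.smooth.differentiable (by simp)).differentiableAt.hasFDerivAt
    have h3 : fderiv ℝ h.toSchwartz x = Complex.ofRealCLM ∘L fderiv ℝ φ x := h2.fderiv
    rw [h3]; rfl
  have ht : (inner ℝ · v : Rn d → ℝ).HasTemperateGrowth := by fun_prop
  rw [← (h.dirDeriv v).fourier_toSchwartz, h1, SchwartzMap.fourier_lineDerivOp_eq]
  simp [SchwartzMap.smulLeftCLM_apply_apply ht, fourier_toSchwartz]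
  ring

theorem fourier_iterate_dirDeriv (h : IsTestFunction Ω φ) (v ξ : Rn d) (n : ℕ) :
    realFourier ((_root_.dirDeriv v)^[n] φ) ξ
      = (2 * Real.pi * Complex.I * (inner ℝ ξ v : ℝ)) ^ n * realFourier φ ξ := by
  induction n with
  | zero => simp
  | succ n ih =>
    rw [Function.iterate_succ_apply', (h.iterate_dirDeriv v n).fourier_dirDeriv, ih]; ring

theorem fourier_foldr_partialDeriv (h : IsTestFunction Ω φ) (α : Fin d → ℕ) (ξ : Rn d)
    (l : List (Fin d)) :
    realFourier (l.foldr (fun i h => (_root_.partialDeriv i)^[α i] h) φ) ξ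
      = (l.map fun i => (2 * Real.pi * Complex.I * (ξ i : ℝ)) ^ α i).prod * realFourier φ ξ := by
  induction l with
  | nil => simp
  | cons i l ih =>
    have h1 := (h.foldr_partialDeriv α l).fourier_iterate_dirDeriv
      (EuclideanSpace.single i 1) ξ (α i)
    rw [ih] at h1
    simp only [EuclideanSpace.inner_single_right] at h1
    rw [List.foldr_cons, List.map_cons, List.prod_cons, mul_assoc]
    refine Eq.trans h1 ?_
    simp

theorem fourier_multiDeriv (h : IsTestFunction Ω φ) (α : Fin d → ℕ) (ξ : Rn d) :
    realFourier (_root_.multiDeriv α φ) ξ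
      = (∏ i, (2 * Real.pi * Complex.I * (ξ i : ℝ)) ^ α i) * realFourier φ ξ := by
  rw [_root_.multiDeriv, h.fourier_foldr_partialDeriv, Fin.prod_univ_def]

theorem integral_conj_fourier_mul (hφ : IsTestFunction Ω φ) (hψ : IsTestFunction Ω ψ) :
    ∫ ξ, starRingEnd ℂ (realFourier φ ξ) * realFourier ψ ξ = ((∫ x, φ x * ψ x : ℝ) : ℂ) := by
  have h := SchwartzMap.integral_inner_fourier_fourier hφ.toSchwartz hψ.toSchwartz
  simp only [RCLike.inner_apply, fourier_toSchwartz, toSchwartz_apply, Complex.conj_ofReal] at h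
  rw [← integral_complex_ofReal]
  simpa [mul_comm] using h

theorem integral_norm_sq_fourier (hφ : IsTestFunction Ω φ) :
    ∫ ξ, ‖realFourier φ ξ‖ ^ 2 = ∫ x, φ x ^ 2 := by
  have h := SchwartzMap.integral_norm_sq_fourier hφ.toSchwartz
  simpa [fourier_toSchwartz] using h

theorem continuous_fourier (hφ : IsTestFunction Ω φ) : Continuous (realFourier φ) :=
  (𝓕 hφ.toSchwartz).continuous

theorem integrable_fourier (hφ : IsTestFunction Ω φ) : Integrable (realFourier φ) :=
  (𝓕 hφ.toSchwartz).integrable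

theorem integrable_norm_sq_fourier (hφ : IsTestFunction Ω φ) :
    Integrable fun ξ => ‖realFourier φ ξ‖ ^ 2 :=
  ((𝓕 hφ.toSchwartz).memLp 2 volume).integrable_norm_pow (by norm_num)

theorem setIntegral_mul (hψ : IsTestFunction Ω ψ) (f : Rn d → ℝ) :
    ∫ x in Ω, f x * ψ x = ∫ x, f x * ψ x :=
  setIntegral_eq_integral_of_forall_compl_eq_zero fun x hx => by
    rw [hψ.eq_zero_of_notMem hx, mul_zero]

theorem setIntegral_sq (hψ : IsTestFunction Ω ψ) : ∫ x in Ω, ψ x ^ 2 = ∫ x, ψ x ^ 2 := by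
  simpa only [sq] using hψ.setIntegral_mul ψ

/-- Integration by parts becomes Plancherel: conjugating the symbol `∏ (2πi ξ_j)^{α_j}` multiplies
it by `(-1)^{|α|}`. -/
theorem hasWeakDeriv (hφ : IsTestFunction Ω φ) (α : Fin d → ℕ) :
    HasWeakDeriv Ω α φ (_root_.multiDeriv α φ) where
  locallyIntegrable_left := hφ.integrable.locallyIntegrable.locallyIntegrableOn Ω
  locallyIntegrable_right :=
    (hφ.multiDeriv α).integrable.locallyIntegrable.locallyIntegrableOn Ω
  integral_eq ψ hψ := by
    rw [(hψ.multiDeriv α).setIntegral_mul, hψ.setIntegral_mul]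
    apply Complex.ofReal_injective
    rw [Complex.ofReal_mul, ← hφ.integral_conj_fourier_mul (hψ.multiDeriv α),
      ← (hφ.multiDeriv α).integral_conj_fourier_mul hψ, ← integral_const_mul]
    refine integral_congr_ae (.of_forall fun ξ => ?_)
    simp only [hφ.fourier_multiDeriv, hψ.fourier_multiDeriv, map_mul, map_prod, map_pow]
    have h1 : ∏ i, (2 * Real.pi * Complex.I * (ξ i : ℝ)) ^ α i
        = (-1) ^ (∑ i, α i) * ∏ i, (starRingEnd ℂ 2 * starRingEnd ℂ Real.pi
          * starRingEnd ℂ Complex.I * starRingEnd ℂ (ξ i : ℝ)) ^ α i := by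
      rw [← Finset.prod_pow_eq_pow_sum, ← Finset.prod_mul_distrib]
      refine Finset.prod_congr rfl fun i _ => ?_
      rw [← mul_pow, map_ofNat]
      simp
    rw [h1]
    push_cast
    ring

end IsTestFunction

/-! ### The Sobolev seminorm on the Fourier side -/

/-- The Fourier symbol `∑_{|α| = m} ∏ (2π ξ_i)^{2 α_i}` of the squared seminorm of order `m`. -/
noncomputable def seminormSymbol {d : ℕ} (m : ℕ) (ξ : Rn d) : ℝ :=
  ∑ α ∈ Finset.piAntidiag Finset.univ m, ∏ i, ((2 * Real.pi * ξ i) ^ 2) ^ α i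

theorem seminormSymbol_nonneg {d : ℕ} (m : ℕ) (ξ : Rn d) : 0 ≤ seminormSymbol m ξ :=
  Finset.sum_nonneg fun _ _ => Finset.prod_nonneg fun _ _ => by positivity

/-- The multinomial theorem. Since each coefficient lies between 1 and the sum of all of them,
`seminormSymbol` is comparable to the left side. -/
theorem norm_sq_pow_eq_sum {d : ℕ} (m : ℕ) (ξ : Rn d) :
    ((2 * Real.pi * ‖ξ‖) ^ 2) ^ m = ∑ α ∈ Finset.piAntidiag Finset.univ m,
      (Nat.multinomial Finset.univ α : ℝ) * ∏ i, ((2 * Real.pi * ξ i) ^ 2) ^ α i := by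
  rw [← Finset.sum_pow_eq_sum_piAntidiag, mul_pow, EuclideanSpace.real_norm_sq_eq,
    Finset.mul_sum]
  simp only [mul_pow]

theorem seminormSymbol_le {d : ℕ} (m : ℕ) (ξ : Rn d) :
    seminormSymbol m ξ ≤ ((2 * Real.pi * ‖ξ‖) ^ 2) ^ m := by
  rw [norm_sq_pow_eq_sum]
  refine Finset.sum_le_sum fun α _ => le_mul_of_one_le_left
    (Finset.prod_nonneg fun _ _ => by positivity) ?_
  exact_mod_cast Nat.multinomial_pos _ _

/-- The sum of the multinomial coefficients of order `m`. -/
noncomputable def multinomialSum (d m : ℕ) : ℝ :=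
  ∑ α ∈ Finset.piAntidiag (Finset.univ : Finset (Fin d)) m, (Nat.multinomial Finset.univ α : ℝ)

theorem multinomialSum_nonneg (d m : ℕ) : 0 ≤ multinomialSum d m :=
  Finset.sum_nonneg fun _ _ => Nat.cast_nonneg _

theorem le_seminormSymbol {d : ℕ} (m : ℕ) (ξ : Rn d) :
    ((2 * Real.pi * ‖ξ‖) ^ 2) ^ m ≤ multinomialSum d m * seminormSymbol m ξ := by
  rw [norm_sq_pow_eq_sum, seminormSymbol, Finset.mul_sum]
  refine Finset.sum_le_sum fun α hα => mul_le_mul_of_nonneg_right ?_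
    (Finset.prod_nonneg fun _ _ => by positivity)
  exact Finset.single_le_sum (f := fun α => (Nat.multinomial Finset.univ α : ℝ))
    (fun _ _ => Nat.cast_nonneg _) hα

theorem add_pow_le_two_pow_mul {a : ℝ} (ha : 0 ≤ a) (m : ℕ) :
    (1 + a) ^ m ≤ 2 ^ m * (1 + a ^ m) := by
  rcases le_total a 1 with h | h
  · calc (1 + a) ^ m ≤ 2 ^ m := by gcongr; linarith
      _ ≤ 2 ^ m * (1 + a ^ m) := le_mul_of_one_le_right (by positivity)
          (le_add_of_nonneg_right (by positivity))
  · calc (1 + a) ^ m ≤ (2 * a) ^ m := by gcongr; linarith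
      _ = 2 ^ m * a ^ m := mul_pow ..
      _ ≤ 2 ^ m * (1 + a ^ m) := by gcongr; linarith

namespace IsTestFunction

variable {d : ℕ} {Ω : Set (Rn d)} {φ ψ : Rn d → ℝ}

theorem norm_fourier_multiDeriv_sq (h : IsTestFunction Ω φ) (α : Fin d → ℕ) (ξ : Rn d) :
    ‖realFourier (_root_.multiDeriv α φ) ξ‖ ^ 2
      = (∏ i, ((2 * Real.pi * ξ i) ^ 2) ^ α i) * ‖realFourier φ ξ‖ ^ 2 := by
  rw [h.fourier_multiDeriv, norm_mul, mul_pow, norm_prod, ← Finset.prod_pow]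
  congr 1
  refine Finset.prod_congr rfl fun i _ => ?_
  rw [norm_pow, pow_right_comm]
  congr 1
  simp [mul_pow, abs_of_pos Real.pi_pos]

theorem integrable_symbol_mul (h : IsTestFunction Ω φ) (m : ℕ) :
    Integrable fun ξ => seminormSymbol m ξ * ‖realFourier φ ξ‖ ^ 2 := by
  simp only [seminormSymbol, Finset.sum_mul, ← h.norm_fourier_multiDeriv_sq]
  exact integrable_finsetSum _ fun α _ => (h.multiDeriv α).integrable_norm_sq_fourier

theorem sum_integral_multiDeriv_sq (h : IsTestFunction Ω φ) (m : ℕ) :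
    ∑ α ∈ Finset.piAntidiag Finset.univ m, ∫ x, _root_.multiDeriv α φ x ^ 2
      = ∫ ξ, seminormSymbol m ξ * ‖realFourier φ ξ‖ ^ 2 := by
  simp only [seminormSymbol, Finset.sum_mul, ← h.norm_fourier_multiDeriv_sq]
  rw [integral_finsetSum _ fun α _ => (h.multiDeriv α).integrable_norm_sq_fourier]
  exact Finset.sum_congr rfl fun α _ => ((h.multiDeriv α).integral_norm_sq_fourier).symm

/-- **Poincaré's inequality** for test functions supported between two parallel hyperplanes. -/
theorem integral_sq_le_integral_dirDeriv_sq (h : IsTestFunction Ω φ) {v : Rn d} {a b : ℝ}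
    (hv : v ≠ 0) (hab : ∀ x ∈ Ω, a ≤ inner ℝ v x ∧ inner ℝ v x ≤ b) :
    ∫ x, φ x ^ 2 ≤ (2 * (b - a) / ‖v‖ ^ 2) ^ 2 * ∫ x, _root_.dirDeriv v φ x ^ 2 := by
  set c : ℝ := 2 * (b - a) / ‖v‖ ^ 2
  have hv' : (0 : ℝ) < ‖v‖ ^ 2 := by positivity
  -- An affine function with `∂_v ℓ = 1` and `0 ≤ 2ℓ ≤ c` on `Ω`; integrating `φ² ∂_v ℓ` by parts
  -- gives `∫ φ² = -∫ 2 φ (∂_v φ) ℓ`.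
  let ℓ : Rn d → ℝ := fun x => (inner ℝ v x - a) / ‖v‖ ^ 2
  have hℓ : ∀ x, HasFDerivAt ℓ ((‖v‖ ^ 2)⁻¹ • innerSL ℝ v) x := fun x => by
    have := (((innerSL ℝ v).hasFDerivAt (x := x)).sub_const a).mul_const ((‖v‖ ^ 2)⁻¹)
    simpa [ℓ, div_eq_mul_inv] using this
  have hℓc : Continuous ℓ := by fun_prop
  have hℓv : ∀ x, fderiv ℝ ℓ x v = 1 := fun x => by
    rw [(hℓ x).fderiv]
    simp [hv'.ne']
  have hd : Differentiable ℝ φ := h.smooth.differentiable (by simp)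
  have hsq : ∀ x, fderiv ℝ (fun x => φ x ^ 2) x v = 2 * φ x * _root_.dirDeriv v φ x := fun x => by
    rw [((hd x).hasFDerivAt.pow 2).fderiv]
    simp [_root_.dirDeriv]
  have i1 : Integrable fun x => φ x * _root_.dirDeriv v φ x :=
    h.mul_integrable (h.dirDeriv v).continuous
  have i2 : Integrable fun x => φ x * (ℓ x * _root_.dirDeriv v φ x) :=
    h.mul_integrable (hℓc.mul (h.dirDeriv v).continuous)
  have hp := integral_mul_fderiv_eq_neg_fderiv_mul_of_integrable (μ := volume)
    (f := fun x => φ x ^ 2) (g := ℓ) (v := v)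
    (by simp only [hsq]; exact (i2.const_mul 2).congr (.of_forall fun x => by ring))
    (by simpa only [hℓv, mul_one] using h.sq_integrable)
    (by simpa only [sq, mul_assoc] using
      h.mul_integrable (ψ := fun x => φ x * ℓ x) (h.continuous.mul hℓc))
    (fun x _ => (hd x).pow 2) (fun x _ => (hℓ x).differentiableAt)
  simp only [hℓv, mul_one, hsq] at hp
  -- Young's inequality; the term `φ² / 2` is absorbed on the left afterwards.
  have hpt : ∀ x, -(2 * φ x * _root_.dirDeriv v φ x * ℓ x)
      ≤ (1 / 2) * φ x ^ 2 + c ^ 2 / 2 * _root_.dirDeriv v φ x ^ 2 := by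
    intro x
    by_cases hx : x ∈ Ω
    · obtain ⟨h1, h2⟩ := hab x hx
      have hℓ0 : 0 ≤ 2 * ℓ x := by
        have : 0 ≤ ℓ x := div_nonneg (by linarith) hv'.le
        linarith
      have hℓ1 : 2 * ℓ x ≤ c := by
        simp only [ℓ, c, ← mul_div_assoc]
        gcongr
      have h3 : (2 * ℓ x) ^ 2 ≤ c ^ 2 := by gcongr
      nlinarith [sq_nonneg (φ x + 2 * ℓ x * _root_.dirDeriv v φ x),
        mul_le_mul_of_nonneg_right h3 (sq_nonneg (_root_.dirDeriv v φ x))]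
    · rw [h.eq_zero_of_notMem hx, (h.dirDeriv v).eq_zero_of_notMem hx]
      simp
  have hle : ∫ x, φ x ^ 2
      ≤ (1 / 2) * (∫ x, φ x ^ 2) + c ^ 2 / 2 * ∫ x, _root_.dirDeriv v φ x ^ 2 := by
    rw [← integral_const_mul, ← integral_const_mul, ← integral_add
      (h.sq_integrable.const_mul _) ((h.dirDeriv v).sq_integrable.const_mul _)]
    refine (hp.trans (integral_neg _).symm).le.trans (integral_mono ?_ ?_ hpt)
    · exact (i2.const_mul (-2)).congr (.of_forall fun x => by simp only; ring)
    · exact (h.sq_integrable.const_mul _).add ((h.dirDeriv v).sq_integrable.const_mul _)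
  linarith

theorem integral_sq_le_integral_iterate_dirDeriv_sq (h : IsTestFunction Ω φ) {v : Rn d} {a b : ℝ}
    (hv : v ≠ 0) (hab : ∀ x ∈ Ω, a ≤ inner ℝ v x ∧ inner ℝ v x ≤ b) (n : ℕ) :
    ∫ x, φ x ^ 2
      ≤ ((2 * (b - a) / ‖v‖ ^ 2) ^ 2) ^ n * ∫ x, (_root_.dirDeriv v)^[n] φ x ^ 2 := by
  induction n with
  | zero => simp
  | succ n ih =>
    refine ih.trans ?_
    rw [pow_succ _ n, mul_assoc, Function.iterate_succ_apply']
    gcongr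
    exact (h.iterate_dirDeriv v n).integral_sq_le_integral_dirDeriv_sq hv hab

theorem integrable_pow_mul_fourier (h : IsTestFunction Ω φ) (m : ℕ) :
    Integrable fun ξ => ((2 * Real.pi * ‖ξ‖) ^ 2) ^ m * ‖realFourier φ ξ‖ ^ 2 := by
  refine ((h.integrable_symbol_mul m).const_mul (multinomialSum d m)).mono' ?_
    (.of_forall fun ξ => ?_)
  · have := h.continuous_fourier
    exact Continuous.aestronglyMeasurable (by fun_prop)
  · rw [Real.norm_of_nonneg (by positivity), ← mul_assoc]
    gcongr
    exact le_seminormSymbol m ξ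

theorem integrable_weight_mul_fourier (h : IsTestFunction Ω φ) (m : ℕ) :
    Integrable fun ξ => (1 + ‖(2 * Real.pi) • ξ‖ ^ 2) ^ m * ‖realFourier φ ξ‖ ^ 2 := by
  refine ((h.integrable_norm_sq_fourier.add (h.integrable_pow_mul_fourier m)).const_mul
    (2 ^ m)).mono' ?_ (.of_forall fun ξ => ?_)
  · have := h.continuous_fourier
    exact Continuous.aestronglyMeasurable (by fun_prop)
  · rw [Real.norm_of_nonneg (by positivity), norm_smul,
      Real.norm_of_nonneg (by positivity : 0 ≤ 2 * Real.pi)]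
    refine (mul_le_mul_of_nonneg_right (add_pow_le_two_pow_mul (by positivity) m)
      (by positivity)).trans_eq ?_
    simp only [Pi.add_apply]; ring

/-- The full Sobolev norm of a test function on a set of finite width is controlled by its
seminorm of highest order. -/
theorem integral_weight_mul_fourier_le (hΩ : HasFiniteWidth Ω) (m : ℕ) :
    ∃ C : ℝ, 0 ≤ C ∧ ∀ φ : Rn d → ℝ, IsTestFunction Ω φ →
      ∫ ξ, (1 + ‖(2 * Real.pi) • ξ‖ ^ 2) ^ m * ‖realFourier φ ξ‖ ^ 2
        ≤ C * ∫ ξ, seminormSymbol m ξ * ‖realFourier φ ξ‖ ^ 2 := by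
  obtain ⟨v, hv, a, b, hab⟩ := hΩ
  set c : ℝ := (2 * (b - a) / ‖v‖ ^ 2) ^ 2
  have hc : 0 ≤ c := by positivity
  have hM := multinomialSum_nonneg d m
  -- The factor `2 ^ m` splits the weight into `1 + ‖2πξ‖^{2m}`. Poincaré applied `m` times in
  -- direction `v`, with `|⟨ξ, v⟩| ≤ ‖ξ‖ ‖v‖`, bounds the integral of the first term by `(c ‖v‖²)^m`
  -- times that of the second, and `multinomialSum` passes to the seminorm symbol.
  refine ⟨2 ^ m * ((c * ‖v‖ ^ 2) ^ m + 1) * multinomialSum d m, by positivity, fun φ h => ?_⟩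
  have hP : ∫ ξ, ‖realFourier φ ξ‖ ^ 2
      ≤ (c * ‖v‖ ^ 2) ^ m * ∫ ξ, ((2 * Real.pi * ‖ξ‖) ^ 2) ^ m * ‖realFourier φ ξ‖ ^ 2 := by
    rw [h.integral_norm_sq_fourier]
    refine (h.integral_sq_le_integral_iterate_dirDeriv_sq hv hab m).trans ?_
    rw [mul_pow, mul_assoc]
    gcongr
    rw [← (h.iterate_dirDeriv v m).integral_norm_sq_fourier, ← integral_const_mul]
    refine integral_mono (h.iterate_dirDeriv v m).integrable_norm_sq_fourier
      ((h.integrable_pow_mul_fourier m).const_mul _) fun ξ => ?_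
    simp only
    rw [h.fourier_iterate_dirDeriv, norm_mul, mul_pow, ← mul_assoc, norm_pow, ← pow_mul,
      mul_comm m 2, pow_mul, ← mul_pow]
    gcongr
    have h1 : |inner ℝ ξ v| ≤ ‖ξ‖ * ‖v‖ := abs_real_inner_le_norm ξ v
    have h2 : ‖(2 * Real.pi * Complex.I * (inner ℝ ξ v : ℝ) : ℂ)‖
        = 2 * Real.pi * |inner ℝ ξ v| := by
      simp [abs_of_pos Real.pi_pos]
    rw [h2, ← mul_pow]
    gcongr ?_ ^ 2
    calc 2 * Real.pi * |inner ℝ ξ v| ≤ 2 * Real.pi * (‖ξ‖ * ‖v‖) := by gcongr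
      _ = _ := by ring
  have hQ : ∫ ξ, ((2 * Real.pi * ‖ξ‖) ^ 2) ^ m * ‖realFourier φ ξ‖ ^ 2
      ≤ multinomialSum d m * ∫ ξ, seminormSymbol m ξ * ‖realFourier φ ξ‖ ^ 2 := by
    rw [← integral_const_mul]
    refine integral_mono (h.integrable_pow_mul_fourier m)
      ((h.integrable_symbol_mul m).const_mul _) fun ξ => ?_
    simp only [← mul_assoc]
    gcongr
    exact le_seminormSymbol m ξ
  have hR : ∫ ξ, (1 + ‖(2 * Real.pi) • ξ‖ ^ 2) ^ m * ‖realFourier φ ξ‖ ^ 2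
      ≤ 2 ^ m * ((∫ ξ, ‖realFourier φ ξ‖ ^ 2)
        + ∫ ξ, ((2 * Real.pi * ‖ξ‖) ^ 2) ^ m * ‖realFourier φ ξ‖ ^ 2) := by
    rw [← integral_add h.integrable_norm_sq_fourier (h.integrable_pow_mul_fourier m),
      ← integral_const_mul]
    refine integral_mono (h.integrable_weight_mul_fourier m)
      ((h.integrable_norm_sq_fourier.add (h.integrable_pow_mul_fourier m)).const_mul _)
      fun ξ => ?_
    simp only
    rw [norm_smul, Real.norm_of_nonneg (by positivity : 0 ≤ 2 * Real.pi)]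
    refine (mul_le_mul_of_nonneg_right (add_pow_le_two_pow_mul (by positivity) m)
      (by positivity)).trans_eq ?_
    ring
  refine hR.trans ?_
  rw [mul_assoc, mul_assoc]
  gcongr
  calc _ ≤ _ := add_le_add_left hP _
    _ = ((c * ‖v‖ ^ 2) ^ m + 1)
        * ∫ ξ, ((2 * Real.pi * ‖ξ‖) ^ 2) ^ m * ‖realFourier φ ξ‖ ^ 2 := by ring
    _ ≤ _ := by gcongr

end IsTestFunction

/-! ### Reproducing kernel Hilbert spaces of scalar kernels -/

/-- The class speaks of distinct points, whereas shifted or sampled families may repeat points; the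
coefficients over each repeated point are added up. -/
theorem IsPosDefKernel.sum_nonneg {X ι : Type*} [Fintype ι] (k : X → X → ℝ)
    [hk : IsPosDefKernel k] (x : ι → X) (c : ι → ℝ) :
    0 ≤ ∑ i, ∑ j, c i * c j * k (x i) (x j) := by
  classical
  have hmaps : ∀ i ∈ (Finset.univ : Finset ι), x i ∈ Finset.univ.image x :=
    fun i _ => Finset.mem_image_of_mem x (Finset.mem_univ i)
  refine (hk.nonneg (Finset.univ.image x) fun y => ∑ i with x i = y, c i).trans_eq ?_
  rw [← Finset.sum_fiberwise_of_maps_to hmaps]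
  refine Finset.sum_congr rfl fun y _ => ?_
  calc ∑ z ∈ Finset.univ.image x, (∑ i with x i = y, c i) * (∑ j with x j = z, c j) * k y z
      = ∑ z ∈ Finset.univ.image x, ∑ j with x j = z,
          (∑ i with x i = y, c i) * c j * k y (x j) := by
        refine Finset.sum_congr rfl fun z _ => ?_
        rw [Finset.mul_sum, Finset.sum_mul]
        refine Finset.sum_congr rfl fun j hj => ?_
        rw [(Finset.mem_filter.1 hj).2]
    _ = ∑ j, (∑ i with x i = y, c i) * c j * k y (x j) :=
        Finset.sum_fiberwise_of_maps_to hmaps _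
    _ = ∑ j, ∑ i with x i = y, c i * c j * k (x i) (x j) := by
        refine Finset.sum_congr rfl fun j _ => ?_
        rw [Finset.sum_mul, Finset.sum_mul]
        refine Finset.sum_congr rfl fun i hi => ?_
        rw [(Finset.mem_filter.1 hi).2]
    _ = ∑ i with x i = y, ∑ j, c i * c j * k (x i) (x j) := Finset.sum_comm

section RKHSOn

variable {X : Type*} {k : X → X → ℝ} [IsPosDefKernel k] {Ω : Set X}

variable (k Ω) in
/-- The section `k(·, x)` of the kernel, as an element of the Hilbert space. -/
noncomputable def kernelSection (x : Ω) : RKHSOn k Ω := RKHS.kerFun (RKHSOn k Ω) x (1 : ℝ)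

theorem inner_kernelSection_left (x : Ω) (h : RKHSOn k Ω) :
    inner ℝ (kernelSection k Ω x) h = h x := by
  rw [kernelSection, RKHS.kerFun_inner]
  simp

theorem inner_kernelSection (x y : Ω) :
    inner ℝ (kernelSection k Ω x) (kernelSection k Ω y) = k x y := by
  rw [kernelSection, kernelSection, ← RKHS.kernel_inner, RKHS.OfKernel.kernel_ofKernel]
  simp [kernelMatrix, IsPosDefKernel.symm (k := k) (y : X) x]

theorem norm_sq_sum_kernelSection {ι : Type*} (s : Finset ι) (x : ι → Ω) (c : ι → ℝ) :
    ‖∑ i ∈ s, c i • kernelSection k Ω (x i)‖ ^ 2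
      = ∑ i ∈ s, ∑ j ∈ s, c i * c j * k (x i) (x j) := by
  rw [← real_inner_self_eq_norm_sq, sum_inner]
  refine Finset.sum_congr rfl fun i _ => ?_
  rw [inner_sum]
  refine Finset.sum_congr rfl fun j _ => ?_
  rw [real_inner_smul_left, real_inner_smul_right, inner_kernelSection, mul_assoc]

theorem sq_sum_mul_apply_le {ι : Type*} (s : Finset ι) (x : ι → Ω) (c : ι → ℝ)
    (h : RKHSOn k Ω) :
    (∑ i ∈ s, c i * h (x i)) ^ 2
      ≤ ‖h‖ ^ 2 * ∑ i ∈ s, ∑ j ∈ s, c i * c j * k (x i) (x j) := by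
  have h1 : ∑ i ∈ s, c i * h (x i) = inner ℝ (∑ i ∈ s, c i • kernelSection k Ω (x i)) h := by
    rw [sum_inner]
    exact Finset.sum_congr rfl fun i _ => by
      rw [real_inner_smul_left, inner_kernelSection_left]
  rw [h1, ← norm_sq_sum_kernelSection, mul_comm, ← mul_pow, ← sq_abs]
  gcongr
  exact abs_real_inner_le_norm _ _

/-- A function belongs to the reproducing kernel Hilbert space, with norm at most `C`, as soon as
its values are controlled by the quadratic form of the kernel. -/
theorem exists_coe_eq_of_sq_sum_le (f : Ω → ℝ) {C : ℝ} (hC : 0 ≤ C)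
    (hf : ∀ (s : Finset Ω) (c : Ω → ℝ), (∑ x ∈ s, c x * f x) ^ 2
      ≤ C ^ 2 * ∑ x ∈ s, ∑ y ∈ s, c x * c y * k x y) :
    ∃ h : RKHSOn k Ω, (h : Ω → ℝ) = f ∧ ‖h‖ ≤ C := by
  let T : (Ω →₀ ℝ) →ₗ[ℝ] RKHSOn k Ω := Finsupp.linearCombination ℝ (kernelSection k Ω)
  let L : (Ω →₀ ℝ) →ₗ[ℝ] ℝ := Finsupp.linearCombination ℝ f
  have hL : ∀ c, ‖L c‖ ≤ C * ‖T c‖ := fun c => by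
    rw [Real.norm_eq_abs]
    refine abs_le_of_sq_le_sq ?_ (mul_nonneg hC (norm_nonneg _))
    rw [mul_pow]
    simp only [T, L, Finsupp.linearCombination_apply, Finsupp.sum, smul_eq_mul]
    rw [norm_sq_sum_kernelSection c.support (fun x => x) c]
    exact hf c.support c
  -- A linear choice of coefficients for each element of the span of the kernel sections. By `hL`
  -- the value of `L` does not depend on the choice, so `L ∘ g` is a bounded functional on the span;
  -- Hahn–Banach extends it and Riesz represents it.
  obtain ⟨g, hg⟩ := T.rangeRestrict.exists_rightInverse_of_surjective T.range_rangeRestrict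
  have hg' : ∀ u : LinearMap.range T, T (g u) = u := fun u =>
    congrArg Subtype.val (LinearMap.congr_fun hg u)
  let ℓ : StrongDual ℝ (LinearMap.range T) := (L ∘ₗ g).mkContinuous C fun u => by
    have := hL (g u)
    rwa [hg'] at this
  obtain ⟨F, hF, hFn⟩ := exists_extension_norm_eq (LinearMap.range T) ℓ
  refine ⟨(InnerProductSpace.toDual ℝ (RKHSOn k Ω)).symm F, funext fun x => ?_, ?_⟩
  · rw [← inner_kernelSection_left, real_inner_comm, InnerProductSpace.toDual_symm_apply]
    have hx : T (Finsupp.single x 1) = kernelSection k Ω x := by simp [T]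
    have hx' : L (Finsupp.single x 1) = f x := by simp [L]
    have h1 := hF ⟨T (Finsupp.single x 1), LinearMap.mem_range_self T _⟩
    rw [← hx, ← hx']
    refine h1.trans (sub_eq_zero.1 (norm_le_zero_iff.1 ?_))
    change ‖L (g _) - L _‖ ≤ 0
    rw [← map_sub]
    refine (hL _).trans_eq ?_
    rw [map_sub, hg', sub_self, norm_zero, mul_zero]
  · rw [LinearIsometryEquiv.norm_map, hFn]
    exact LinearMap.mkContinuous_norm_le _ hC _

end RKHSOn

/-! ### Translation-invariant positive definite kernels -/

theorem translationKernel_neg {d : ℕ} {κ : Rn d → ℝ} [hκ : IsPosDefKernel (translationKernel κ)]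
    (x : Rn d) : κ (-x) = κ x := by
  simpa [translationKernel] using hκ.symm 0 x

/-- A positive definite quadratic form of translates is largest at the zero shift. -/
theorem abs_sum_translate_le {d : ℕ} {κ : Rn d → ℝ} [hκ : IsPosDefKernel (translationKernel κ)]
    {ι : Type*} [Fintype ι] (x : ι → Rn d) (c : ι → ℝ) (z : Rn d) :
    |∑ i, ∑ j, c i * c j * κ (z + (x i - x j))| ≤ ∑ i, ∑ j, c i * c j * κ (x i - x j) := by
  have key : ∀ ε : ℝ, ε ^ 2 = 1 →
      0 ≤ 2 * (∑ i, ∑ j, c i * c j * κ (x i - x j))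
        + 2 * ε * ∑ i, ∑ j, c i * c j * κ (z + (x i - x j)) := by
    intro ε hε
    -- Points `x_i + z` with weights `c_i`, together with points `x_i` with weights `ε c_i`. Each
    -- diagonal block gives the unshifted form and each cross block gives `ε` times the shifted one.
    have h := IsPosDefKernel.sum_nonneg (translationKernel κ)
      (Sum.elim (fun i => x i + z) x : ι ⊕ ι → Rn d) (Sum.elim c fun i => ε * c i)
    simp only [Fintype.sum_sum_type, Sum.elim_inl, Sum.elim_inr, translationKernel] at h
    have e1 : ∀ i j, x i + z - (x j + z) = x i - x j := fun i j => by abel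
    have e2 : ∀ i j, x i + z - x j = z + (x i - x j) := fun i j => by abel
    have e3 : ∀ i j, κ (x i - (x j + z)) = κ (z + (x j - x i)) := fun i j => by
      rw [← translationKernel_neg (κ := κ)]; congr 1; abel
    simp only [e1, e2, e3, Finset.sum_add_distrib] at h
    have s1 : ∑ i, ∑ j, ε * c i * c j * κ (z + (x j - x i))
        = ε * ∑ i, ∑ j, c i * c j * κ (z + (x i - x j)) := by
      rw [Finset.sum_comm, Finset.mul_sum]
      refine Finset.sum_congr rfl fun i _ => ?_
      rw [Finset.mul_sum]
      exact Finset.sum_congr rfl fun j _ => by ring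
    have s2 : ∑ i, ∑ j, c i * (ε * c j) * κ (z + (x i - x j))
        = ε * ∑ i, ∑ j, c i * c j * κ (z + (x i - x j)) := by
      rw [Finset.mul_sum]
      refine Finset.sum_congr rfl fun i _ => ?_
      rw [Finset.mul_sum]
      exact Finset.sum_congr rfl fun j _ => by ring
    have s3 : ∑ i, ∑ j, ε * c i * (ε * c j) * κ (x i - x j)
        = ∑ i, ∑ j, c i * c j * κ (x i - x j) := by
      refine Finset.sum_congr rfl fun i _ => Finset.sum_congr rfl fun j _ => ?_
      linear_combination (c i * c j * κ (x i - x j)) * hε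
    rw [s1, s2, s3] at h
    linarith
  have h1 := key 1 (by norm_num)
  have h2 := key (-1) (by norm_num)
  rw [abs_le]
  constructor <;> linarith

/-! ### Kernels with integrable Fourier transform -/

section FourierGeneral

variable {d : ℕ}

theorem integral_fourier_mul_eq_of_integrable {f g : Rn d → ℂ} (hf : Integrable f)
    (hg : Integrable g) : ∫ ξ, 𝓕 f ξ * g ξ = ∫ x, f x * 𝓕 g x := by
  simpa using! VectorFourier.integral_fourierIntegral_smul_eq_flip (L := innerₗ (Rn d))
    Real.continuous_fourierChar continuous_inner hf hg

/-- The continuous version of the integrable function whose Fourier transform is `realFourier κ`. -/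
noncomputable def fourierVersion (κ : Rn d → ℝ) : Rn d → ℂ := 𝓕⁻ (realFourier κ)

theorem fourierVersion_apply (κ : Rn d → ℝ) (x : Rn d) :
    fourierVersion κ x
      = ∫ ξ, Complex.exp (2 * Real.pi * Complex.I * (inner ℝ ξ x : ℝ)) * realFourier κ ξ := by
  rw [fourierVersion, Real.fourierInv_eq']
  refine integral_congr_ae (.of_forall fun ξ => ?_)
  simp only [smul_eq_mul]
  congr 2
  push_cast
  ring

theorem continuous_fourierVersion {κ : Rn d → ℝ} (hκ : Integrable (realFourier κ)) :
    Continuous (fourierVersion κ) := by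
  rw [fourierVersion, Real.fourierInv_eq_fourier_comp_neg]
  exact VectorFourier.fourierIntegral_continuous Real.continuous_fourierChar
    (L := innerₗ (Rn d)) continuous_inner hκ.comp_neg

theorem continuous_realFourier {κ : Rn d → ℝ} (hκ : Integrable κ) :
    Continuous (realFourier κ) :=
  VectorFourier.fourierIntegral_continuous Real.continuous_fourierChar
    (L := innerₗ (Rn d)) continuous_inner hκ.ofReal

/-- Fourier inversion almost everywhere, for integrable functions with integrable transform. -/
theorem ae_eq_fourierVersion {κ : Rn d → ℝ} (hκ : Integrable κ)
    (hκ' : Integrable (realFourier κ)) : ∀ᵐ x, (κ x : ℂ) = fourierVersion κ x := by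
  refine ae_eq_of_integral_contDiff_smul_eq hκ.ofReal.locallyIntegrable
    (continuous_fourierVersion hκ').locallyIntegrable fun g hg hgc => ?_
  have ht : IsTestFunction Set.univ g := ⟨hg, hgc, Set.subset_univ _⟩
  set G : 𝓢(Rn d, ℂ) := ht.toSchwartz
  have hG : ∀ x, (g x : ℂ) = G x := fun _ => rfl
  simp only [Complex.real_smul, hG]
  -- The multiplication formula moves the transform from `realFourier κ` to the test function and
  -- then back onto `κ`.
  have e1 : ∫ x, G x * fourierVersion κ x = ∫ x, 𝓕 (G : Rn d → ℂ) x * realFourier κ (-x) := by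
    rw [integral_fourier_mul_eq_of_integrable G.integrable hκ'.comp_neg, fourierVersion,
      Real.fourierInv_eq_fourier_comp_neg]
  have e2 : ∫ x, 𝓕 (G : Rn d → ℂ) x * realFourier κ (-x)
      = ∫ x, (𝓕⁻ G) x * realFourier κ x := by
    rw [← integral_neg_eq_self]
    refine integral_congr_ae (.of_forall fun x => ?_)
    simp only [neg_neg, SchwartzMap.fourierInv_coe, Real.fourierInv_eq_fourier_neg]
  have e3 : ∫ x, (𝓕⁻ G) x * realFourier κ x = ∫ x, 𝓕 (𝓕⁻ G) x * (κ x : ℂ) :=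
    (integral_fourier_mul_eq_of_integrable (𝓕⁻ G).integrable hκ.ofReal).symm
  rw [e1, e2, e3, FourierTransform.fourier_fourierInv_eq]

theorem realFourier_neg (g : Rn d → ℝ) (ξ : Rn d) :
    realFourier g (-ξ) = starRingEnd ℂ (realFourier g ξ) := by
  simp only [realFourier, Real.fourier_eq', ← integral_conj]
  refine integral_congr_ae (.of_forall fun x => ?_)
  simp [← Complex.exp_conj, map_ofNat]

/-- The energy of an integrable density with respect to a kernel, on the Fourier side. -/
theorem integral_integral_mul_fourierVersion {κ g : Rn d → ℝ} (hκ : Integrable (realFourier κ))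
    (hg : Integrable g) :
    ∫ x, (g x : ℂ) * ∫ y, (g y : ℂ) * fourierVersion κ (x - y)
      = ∫ ξ, realFourier κ ξ * (‖realFourier g ξ‖ ^ 2 : ℝ) := by
  have hgc : Continuous (realFourier g) := continuous_realFourier hg
  have hgC : Integrable fun x => (g x : ℂ) := hg.ofReal
  have hexp : ∀ x : Rn d, Integrable fun ξ =>
      Complex.exp (2 * Real.pi * Complex.I * (inner ℝ ξ x : ℝ)) * realFourier κ ξ := fun x => by
    refine hκ.bdd_mul (c := 1) (Continuous.aestronglyMeasurable (by fun_prop))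
      (.of_forall fun ξ => le_of_eq ?_)
    rw [Complex.norm_exp]; simp
  -- The convolution theorem: translating by `x` is a modulation of the transform, and the
  -- multiplication formula does the rest.
  have hin : ∀ x : Rn d, ∫ y, (g y : ℂ) * fourierVersion κ (x - y)
      = 𝓕⁻ (fun ξ => realFourier g ξ * realFourier κ ξ) x := by
    intro x
    have h1 : ∀ y, fourierVersion κ (x - y) = 𝓕 (fun ξ =>
        Complex.exp (2 * Real.pi * Complex.I * (inner ℝ ξ x : ℝ)) * realFourier κ ξ) y := by
      intro y
      rw [fourierVersion_apply, Real.fourier_eq']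
      refine integral_congr_ae (.of_forall fun ξ => ?_)
      simp only [smul_eq_mul, ← mul_assoc, ← Complex.exp_add]
      congr 2
      rw [inner_sub_right]
      push_cast
      ring
    simp only [h1]
    rw [← integral_fourier_mul_eq_of_integrable hgC (hexp x), Real.fourierInv_eq']
    refine integral_congr_ae (.of_forall fun ξ => ?_)
    simp only [smul_eq_mul, ← mul_assoc]
    rw [mul_comm (𝓕 (fun x => (g x : ℂ)) ξ), realFourier]
    congr 3
    push_cast
    ring
  have hprod : Integrable fun ξ => realFourier g ξ * realFourier κ ξ := by
    obtain ⟨C, hC⟩ : ∃ C, ∀ ξ, ‖realFourier g ξ‖ ≤ C :=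
      ⟨_, fun ξ => VectorFourier.norm_fourierIntegral_le_integral_norm _ _ _ _ ξ⟩
    exact hκ.bdd_mul hgc.aestronglyMeasurable (.of_forall hC)
  simp only [hin, Real.fourierInv_eq_fourier_comp_neg]
  rw [← integral_fourier_mul_eq_of_integrable hgC hprod.comp_neg, ← integral_neg_eq_self]
  refine integral_congr_ae (.of_forall fun ξ => ?_)
  change realFourier g (-ξ) * (realFourier g (- -ξ) * realFourier κ (- -ξ)) = _
  rw [neg_neg, realFourier_neg, ← mul_assoc, mul_comm, Complex.conj_mul']
  push_cast
  rfl

/-- The quadratic form of the continuous version of a kernel, on the Fourier side. -/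
theorem sum_mul_fourierVersion {κ : Rn d → ℝ} (hκ : Integrable (realFourier κ)) {ι : Type*}
    (s : Finset ι) (x : ι → Rn d) (c : ι → ℝ) :
    ∑ i ∈ s, ∑ j ∈ s, (c i * c j : ℂ) * fourierVersion κ (x i - x j)
      = ∫ ξ, realFourier κ ξ * (‖∑ i ∈ s, (c i : ℂ)
          * Complex.exp (2 * Real.pi * Complex.I * (inner ℝ ξ (x i) : ℝ))‖ ^ 2 : ℝ) := by
  have hexp : ∀ z : Rn d, Integrable fun ξ =>
      Complex.exp (2 * Real.pi * Complex.I * (inner ℝ ξ z : ℝ)) * realFourier κ ξ := fun z => by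
    refine hκ.bdd_mul (c := 1) (Continuous.aestronglyMeasurable (by fun_prop))
      (.of_forall fun ξ => le_of_eq ?_)
    rw [Complex.norm_exp]; simp
  symm
  calc _ = ∫ ξ, ∑ i ∈ s, ∑ j ∈ s, (c i * c j : ℂ)
        * (Complex.exp (2 * Real.pi * Complex.I * (inner ℝ ξ (x i - x j) : ℝ))
          * realFourier κ ξ) := by
        refine integral_congr_ae (.of_forall fun ξ => ?_)
        simp only [Complex.ofReal_pow]
        rw [← Complex.mul_conj', map_sum, Finset.sum_mul_sum, Finset.mul_sum]
        refine Finset.sum_congr rfl fun i _ => ?_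
        rw [Finset.mul_sum]
        refine Finset.sum_congr rfl fun j _ => ?_
        have he : Complex.exp (2 * Real.pi * Complex.I * (inner ℝ ξ (x i - x j) : ℝ))
            = Complex.exp (2 * Real.pi * Complex.I * (inner ℝ ξ (x i) : ℝ))
              * starRingEnd ℂ (Complex.exp (2 * Real.pi * Complex.I * (inner ℝ ξ (x j) : ℝ))) := by
          rw [← Complex.exp_conj, ← Complex.exp_add, inner_sub_right]
          congr 1
          simp [map_ofNat]
          ring
        rw [he, map_mul, Complex.conj_ofReal]
        ring
    _ = _ := by
        rw [integral_finsetSum _ fun i _ => integrable_finsetSum _ fun j _ =>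
          (hexp (x i - x j)).const_mul (c i * c j : ℂ)]
        refine Finset.sum_congr rfl fun i _ => ?_
        rw [integral_finsetSum _ fun j _ => (hexp (x i - x j)).const_mul (c i * c j : ℂ)]
        refine Finset.sum_congr rfl fun j _ => ?_
        rw [fourierVersion_apply, integral_const_mul]

end FourierGeneral

/-! ### Kernels with algebraically decaying Fourier transform -/

section Decay

variable {d : ℕ}

/-- The weight `(1 + ‖2πξ‖²)^{-m}`. -/
noncomputable def decayWeight (m : ℕ) (ξ : Rn d) : ℝ := ((1 + ‖(2 * Real.pi) • ξ‖ ^ 2) ^ m)⁻¹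

theorem decayWeight_pos (m : ℕ) (ξ : Rn d) : 0 < decayWeight m ξ := by
  unfold decayWeight; positivity

theorem continuous_decayWeight (m : ℕ) : Continuous (decayWeight m : Rn d → ℝ) := by
  unfold decayWeight
  exact Continuous.inv₀ (by fun_prop) fun ξ => by positivity

theorem integrable_decayWeight {m : ℕ} (hdm : (d : ℝ) / 2 < m) :
    Integrable (decayWeight m : Rn d → ℝ) := by
  have h := integrable_rpow_neg_one_add_norm_sq (E := Rn d) (μ := volume) (r := 2 * m)
    (by rw [finrank_euclideanSpace_fin]; linarith)
  refine (h.comp_smul (R := 2 * Real.pi) (by positivity)).congr (.of_forall fun ξ => ?_)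
  simp only [decayWeight]
  rw [show (-(2 * (m : ℝ)) / 2) = -(m : ℝ) by ring, Real.rpow_neg (by positivity),
    Real.rpow_natCast]

theorem fourierHat_eq (κ : Rn d → ℝ) (ξ : Rn d) :
    fourierHat κ ((2 * Real.pi) • ξ)
      = (((2 * Real.pi) ^ (-(d : ℝ) / 2) : ℝ) : ℂ) * realFourier κ ξ := by
  rw [fourierHat, realFourier, Real.fourier_eq']
  congr 1
  refine integral_congr_ae (.of_forall fun x => ?_)
  simp only [smul_eq_mul]
  rw [mul_comm, real_inner_smul_right]
  congr 2
  push_cast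
  ring

/-- Two-sided bounds on the Fourier transform of a kernel, in Mathlib's normalisation. -/
structure FourierBounds (κ : Rn d → ℝ) (m : ℕ) (c₁ c₂ : ℝ) : Prop where
  pos₁ : 0 < c₁
  pos₂ : 0 < c₂
  integrable : Integrable κ
  integrable_fourier : Integrable (realFourier κ)
  ofReal_re : ∀ ξ, ((realFourier κ ξ).re : ℂ) = realFourier κ ξ
  lower : ∀ ξ, c₁ * decayWeight m ξ ≤ (realFourier κ ξ).re
  upper : ∀ ξ, (realFourier κ ξ).re ≤ c₂ * decayWeight m ξ

/-- Changing the normalisation dilates frequencies by `2π` and divides the constants by `A`. The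
condition `m > d/2` makes the weight, hence the transform, integrable. -/
theorem HasFourierDecay.exists_fourierBounds {κ : Rn d → ℝ} {m : ℕ} (h : HasFourierDecay κ m)
    (hdm : (d : ℝ) / 2 < m) (hκ : Integrable κ) : ∃ c₁ c₂ : ℝ, FourierBounds κ m c₁ c₂ := by
  obtain ⟨c₁, c₂, h1, h12, hb⟩ := h
  set A : ℝ := (2 * Real.pi) ^ (-(d : ℝ) / 2)
  have hA : 0 < A := by positivity
  have hre : ∀ ξ, (fourierHat κ ((2 * Real.pi) • ξ)).re = A * (realFourier κ ξ).re := fun ξ => by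
    rw [fourierHat_eq, Complex.re_ofReal_mul]
  have him : ∀ ξ, (realFourier κ ξ).im = 0 := fun ξ => by
    have := (hb ((2 * Real.pi) • ξ)).1
    rw [fourierHat_eq, Complex.im_ofReal_mul] at this
    exact (mul_eq_zero.1 this).resolve_left hA.ne'
  have hofReal : ∀ ξ, ((realFourier κ ξ).re : ℂ) = realFourier κ ξ := fun ξ =>
    Complex.ext (by simp) (by simp [him])
  have hlow : ∀ ξ, c₁ / A * decayWeight m ξ ≤ (realFourier κ ξ).re := fun ξ => by
    have := (hb ((2 * Real.pi) • ξ)).2.1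
    rw [hre] at this
    rw [div_mul_eq_mul_div, div_le_iff₀ hA, mul_comm _ A]
    exact this
  have hupp : ∀ ξ, (realFourier κ ξ).re ≤ c₂ / A * decayWeight m ξ := fun ξ => by
    have := (hb ((2 * Real.pi) • ξ)).2.2
    rw [hre] at this
    rw [div_mul_eq_mul_div, le_div_iff₀ hA, mul_comm _ A]
    exact this
  have h1A : 0 < c₁ / A := div_pos h1 hA
  refine ⟨c₁ / A, c₂ / A, h1A, div_pos (h1.trans_le h12) hA, hκ, ?_, hofReal, hlow, hupp⟩
  refine ((integrable_decayWeight hdm).const_mul (c₂ / A)).mono'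
    (continuous_realFourier hκ).aestronglyMeasurable (.of_forall fun ξ => ?_)
  rw [← hofReal, Complex.norm_real, Real.norm_of_nonneg
    ((mul_pos h1A (decayWeight_pos m ξ)).le.trans (hlow ξ))]
  exact hupp ξ

theorem integral_mul_sq_le {f g : Rn d → ℝ} (hf : Integrable fun x => f x ^ 2)
    (hg : Integrable fun x => g x ^ 2) (hfg : Integrable fun x => f x * g x) :
    (∫ x, f x * g x) ^ 2 ≤ (∫ x, f x ^ 2) * ∫ x, g x ^ 2 := by
  have h : ∀ t : ℝ, 0 ≤ (∫ x, g x ^ 2) * (t * t) + (2 * ∫ x, f x * g x) * t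
      + ∫ x, f x ^ 2 := by
    intro t
    have h0 : 0 ≤ ∫ x, (f x + t * g x) ^ 2 := integral_nonneg fun x => sq_nonneg _
    refine h0.trans_eq ?_
    have e : ∀ x, (f x + t * g x) ^ 2 = t * t * g x ^ 2 + 2 * t * (f x * g x) + f x ^ 2 :=
      fun x => by ring
    simp only [e]
    have i1 : Integrable fun x => t * t * g x ^ 2 + 2 * t * (f x * g x) :=
      (hg.const_mul _).add (hfg.const_mul _)
    rw [integral_add i1 hf, integral_add (hg.const_mul _) (hfg.const_mul _),
      integral_const_mul, integral_const_mul]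
    ring
  have := discrim_le_zero h
  rw [discrim] at this
  nlinarith

namespace FourierBounds

variable {κ : Rn d → ℝ} {m : ℕ} {c₁ c₂ : ℝ}

theorem re_nonneg (h : FourierBounds κ m c₁ c₂) (ξ : Rn d) : 0 ≤ (realFourier κ ξ).re :=
  (mul_pos h.pos₁ (decayWeight_pos m ξ)).le.trans (h.lower ξ)

theorem integrable_re (h : FourierBounds κ m c₁ c₂) :
    Integrable fun ξ => (realFourier κ ξ).re := h.integrable_fourier.re

theorem integrable_decayWeight (h : FourierBounds κ m c₁ c₂) :
    Integrable (decayWeight m : Rn d → ℝ) := by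
  refine (h.integrable_re.const_mul c₁⁻¹).mono'
    (continuous_decayWeight m).aestronglyMeasurable (.of_forall fun ξ => ?_)
  rw [Real.norm_of_nonneg (decayWeight_pos m ξ).le, le_inv_mul_iff₀ h.pos₁]
  exact h.lower ξ

/-- The continuous version of the kernel is dominated by the kernel itself, in the sense of
quadratic forms. -/
theorem integral_re_mul_norm_sq_le [IsPosDefKernel (translationKernel κ)]
    (h : FourierBounds κ m c₁ c₂) {ι : Type*} [Fintype ι] (x : ι → Rn d) (c : ι → ℝ) :
    ∫ ξ, (realFourier κ ξ).re * ‖∑ i, (c i : ℂ)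
        * Complex.exp (2 * Real.pi * Complex.I * (inner ℝ ξ (x i) : ℝ))‖ ^ 2
      ≤ ∑ i, ∑ j, c i * c j * κ (x i - x j) := by
  -- The form of the continuous version, shifted by `z`. For almost every `z` it equals the shifted
  -- form of `κ`, which is bounded by the unshifted one; by continuity the bound survives at `z =
  -- 0`, where `F` is the integral in question.
  let F : Rn d → ℂ := fun z =>
    ∑ i, ∑ j, (c i * c j : ℂ) * fourierVersion κ (z + (x i - x j))
  have hFc : Continuous F := by
    have := continuous_fourierVersion h.integrable_fourier
    fun_prop
  have hF0 : F 0 = ((∫ ξ, (realFourier κ ξ).re * ‖∑ i, (c i : ℂ)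
      * Complex.exp (2 * Real.pi * Complex.I * (inner ℝ ξ (x i) : ℝ))‖ ^ 2 : ℝ) : ℂ) := by
    simp only [F, zero_add]
    rw [sum_mul_fourierVersion h.integrable_fourier, ← integral_complex_ofReal]
    refine integral_congr_ae (.of_forall fun ξ => ?_)
    simp only [Complex.ofReal_mul, h.ofReal_re]
  have hae : ∀ᵐ z, ‖F z‖ ≤ ∑ i, ∑ j, c i * c j * κ (x i - x j) := by
    have hall : ∀ᵐ z, ∀ i j, (κ (z + (x i - x j)) : ℂ) = fourierVersion κ (z + (x i - x j)) := by
      refine ae_all_iff.2 fun i => ae_all_iff.2 fun j => ?_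
      exact (quasiMeasurePreserving_add_right volume (x i - x j)).ae
        (ae_eq_fourierVersion h.integrable h.integrable_fourier)
    filter_upwards [hall] with z hz
    have e : F z = ((∑ i, ∑ j, c i * c j * κ (z + (x i - x j)) : ℝ) : ℂ) := by
      simp only [F, ← hz]
      push_cast
      rfl
    rw [e, Complex.norm_real]
    exact abs_sum_translate_le x c z
  have hle : ‖F 0‖ ≤ ∑ i, ∑ j, c i * c j * κ (x i - x j) := by
    have hcl : IsClosed {z | ‖F z‖ ≤ ∑ i, ∑ j, c i * c j * κ (x i - x j)} :=
      isClosed_le hFc.norm continuous_const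
    have hd := (Measure.dense_of_ae hae).closure_eq
    rw [hcl.closure_eq] at hd
    exact hd.ge (Set.mem_univ (0 : Rn d))
  rw [hF0, Complex.norm_real] at hle
  exact (le_abs_self _).trans hle

/-- The values of a test function are controlled by the quadratic form of the kernel. -/
theorem sq_sum_mul_le [IsPosDefKernel (translationKernel κ)] (h : FourierBounds κ m c₁ c₂)
    {Ω : Set (Rn d)} {φ : Rn d → ℝ} (hφ : IsTestFunction Ω φ) {ι : Type*} [Fintype ι]
    (x : ι → Rn d) (c : ι → ℝ) :
    (∑ i, c i * φ (x i)) ^ 2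
      ≤ (c₁⁻¹ * ∫ ξ, (1 + ‖(2 * Real.pi) • ξ‖ ^ 2) ^ m * ‖realFourier φ ξ‖ ^ 2)
        * ∑ i, ∑ j, c i * c j * κ (x i - x j) := by
  let S : Rn d → ℂ := fun ξ => ∑ i, (c i : ℂ)
    * Complex.exp (2 * Real.pi * Complex.I * (inner ℝ ξ (x i) : ℝ))
  have hSc : Continuous S := by fun_prop
  have hSb : ∀ ξ, ‖S ξ‖ ≤ ∑ i, |c i| := fun ξ => by
    refine (norm_sum_le _ _).trans (Finset.sum_le_sum fun i _ => ?_)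
    rw [norm_mul, Complex.norm_real, Complex.norm_exp]
    simp
  have hφi : ∀ z, (φ z : ℂ) = fourierVersion φ z := fun z => by
    have := congrArg (fun G : 𝓢(Rn d, ℂ) => G z)
      (FourierTransform.fourierInv_fourier_eq (F := 𝓢(Rn d, ℂ)) hφ.toSchwartz)
    simp only [SchwartzMap.fourierInv_coe] at this
    exact this.symm
  have hexp : ∀ z : Rn d, Integrable fun ξ =>
      Complex.exp (2 * Real.pi * Complex.I * (inner ℝ ξ z : ℝ)) * realFourier φ ξ := fun z => by
    refine hφ.integrable_fourier.bdd_mul (c := 1) (Continuous.aestronglyMeasurable (by fun_prop))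
      (.of_forall fun ξ => le_of_eq ?_)
    rw [Complex.norm_exp]; simp
  have hsum : ((∑ i, c i * φ (x i) : ℝ) : ℂ) = ∫ ξ, S ξ * realFourier φ ξ := by
    simp only [S, Finset.sum_mul, mul_assoc]
    simp only [← mul_assoc (2 : ℂ), ← mul_assoc (2 * Real.pi : ℂ)]
    rw [integral_finsetSum _ fun i _ => (hexp (x i)).const_mul (c i : ℂ)]
    push_cast
    refine Finset.sum_congr rfl fun i _ => ?_
    rw [hφi, fourierVersion_apply, integral_const_mul]
  -- Splitting of the integrand for Cauchy–Schwarz: `w^{1/2} |S|` meets the kernel and `w^{-1/2}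
  -- |φ̂|` the Sobolev norm.
  let f : Rn d → ℝ := fun ξ => Real.sqrt (decayWeight m ξ) * ‖S ξ‖
  let g : Rn d → ℝ := fun ξ => (Real.sqrt (decayWeight m ξ))⁻¹ * ‖realFourier φ ξ‖
  have hf2 : ∀ ξ, f ξ ^ 2 = decayWeight m ξ * ‖S ξ‖ ^ 2 := fun ξ => by
    simp only [f, mul_pow, Real.sq_sqrt (decayWeight_pos m ξ).le]
  have hg2 : ∀ ξ, g ξ ^ 2
      = (1 + ‖(2 * Real.pi) • ξ‖ ^ 2) ^ m * ‖realFourier φ ξ‖ ^ 2 := fun ξ => by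
    simp only [g, mul_pow, inv_pow, Real.sq_sqrt (decayWeight_pos m ξ).le]
    simp only [decayWeight, inv_inv]
  have hfg : ∀ ξ, f ξ * g ξ = ‖S ξ * realFourier φ ξ‖ := fun ξ => by
    have := (Real.sqrt_pos.2 (decayWeight_pos m ξ)).ne'
    simp only [f, g, norm_mul]
    field_simp
  have iS : Integrable fun ξ => decayWeight m ξ * ‖S ξ‖ ^ 2 := by
    refine h.integrable_decayWeight.mul_bdd (c := (∑ i, |c i|) ^ 2)
      (hSc.norm.pow 2).aestronglyMeasurable (.of_forall fun ξ => ?_)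
    rw [norm_pow, norm_norm]
    gcongr
    exact hSb ξ
  have iP : Integrable fun ξ => (realFourier κ ξ).re * ‖S ξ‖ ^ 2 := by
    refine h.integrable_re.mul_bdd (c := (∑ i, |c i|) ^ 2)
      (hSc.norm.pow 2).aestronglyMeasurable (.of_forall fun ξ => ?_)
    rw [norm_pow, norm_norm]
    gcongr
    exact hSb ξ
  have hCS := integral_mul_sq_le (f := f) (g := g) (by simpa only [hf2] using iS)
    (by simpa only [hg2] using hφ.integrable_weight_mul_fourier m)
    (by
      simp only [hfg]
      exact (hφ.integrable_fourier.bdd_mul hSc.aestronglyMeasurable (.of_forall hSb)).norm)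
  simp only [hf2, hg2, hfg] at hCS
  have h1 : (∑ i, c i * φ (x i)) ^ 2 ≤ (∫ ξ, ‖S ξ * realFourier φ ξ‖) ^ 2 := by
    rw [← sq_abs, ← Real.norm_eq_abs, ← Complex.norm_real, hsum]
    gcongr
    exact norm_integral_le_integral_norm _
  have h2 : ∫ ξ, decayWeight m ξ * ‖S ξ‖ ^ 2
      ≤ c₁⁻¹ * ∑ i, ∑ j, c i * c j * κ (x i - x j) := by
    rw [le_inv_mul_iff₀ h.pos₁, ← integral_const_mul]
    refine (integral_mono (iS.const_mul c₁) iP fun ξ => ?_).trans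
      (h.integral_re_mul_norm_sq_le x c)
    simp only [← mul_assoc]
    gcongr
    exact h.lower ξ
  refine (h1.trans hCS).trans ?_
  calc _ ≤ (c₁⁻¹ * ∑ i, ∑ j, c i * c j * κ (x i - x j)) * _ :=
        mul_le_mul_of_nonneg_right h2 (integral_nonneg fun ξ => by positivity)
    _ = _ := by ring

end FourierBounds

end Decay

/-! ### Averaging positive definite kernels -/

/-- If all the quadratic forms `∑ G(y_i, y_j)` are nonnegative and `G` is bounded above on the
diagonal, then the mean of `G` over independent pairs is nonnegative. -/
theorem integral_prod_nonneg_of_sum_nonneg {Y : Type*} [MeasurableSpace Y] (ν : Measure Y)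
    [IsProbabilityMeasure ν] {G : Y → Y → ℝ}
    (hG : Integrable (fun p : Y × Y => G p.1 p.2) (ν.prod ν)) {s : Set Y}
    (hs : ∀ᵐ y ∂ν, y ∈ s) {M : ℝ} (hdiag : ∀ y ∈ s, G y y ≤ M)
    (hpos : ∀ (n : ℕ) (y : Fin n → Y), (∀ i, y i ∈ s) → 0 ≤ ∑ i, ∑ j, G (y i) (y j)) :
    0 ≤ ∫ p, G p.1 p.2 ∂(ν.prod ν) := by
  set I := ∫ p, G p.1 p.2 ∂(ν.prod ν)
  -- The expectation of the quadratic form at `n + 1` independent points: `n + 1` diagonal terms,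
  -- each at most `M`, and `(n + 1) n` off-diagonal terms of mean `I`. Letting `n` grow rules out `I
  -- < 0`.
  have key : ∀ n : ℕ, 0 ≤ ((n : ℝ) + 1) * M + ((n : ℝ) + 1) * (n * I) := by
    intro n
    set μ : Measure (Fin (n + 1) → Y) := Measure.pi fun _ => ν
    have hmp : ∀ i j : Fin (n + 1), i ≠ j →
        MeasurePreserving (fun y : Fin (n + 1) → Y => (y i, y j)) μ (ν.prod ν) := by
      intro i j hij
      refine ⟨by fun_prop, ?_⟩
      have hind := (ProbabilityTheory.iIndepFun_pi (μ := fun _ : Fin (n + 1) => ν)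
        (X := fun _ => id) fun _ => aemeasurable_id).indepFun hij
      have hmap := (ProbabilityTheory.indepFun_iff_map_prod_eq_prod_map_map
        (measurable_pi_apply i).aemeasurable (measurable_pi_apply j).aemeasurable).1 hind
      have he : ∀ i : Fin (n + 1), μ.map (fun y => y i) = ν := fun i =>
        (measurePreserving_eval (fun _ : Fin (n + 1) => ν) i).map_eq
      change μ.map _ = (μ.map _).prod (μ.map _) at hmap
      rwa [he, he] at hmap
    have hint : ∀ i j : Fin (n + 1), i ≠ j →
        Integrable (fun y : Fin (n + 1) → Y => G (y i) (y j)) μ := fun i j hij =>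
      (hmp i j hij).integrable_comp_of_integrable hG
    have hval : ∀ i j : Fin (n + 1), i ≠ j → ∫ y, G (y i) (y j) ∂μ = I := fun i j hij => by
      have h1 := (hmp i j hij).map_eq
      have h2 := integral_map (μ := μ) (φ := fun y : Fin (n + 1) → Y => (y i, y j))
        (f := fun p => G p.1 p.2) (by fun_prop) (by rw [h1]; exact hG.aestronglyMeasurable)
      rw [h1] at h2
      exact h2.symm
    have hmem : ∀ᵐ y ∂μ, ∀ i, y i ∈ s := ae_all_iff.2 fun i =>
      (measurePreserving_eval (fun _ : Fin (n + 1) => ν) i).quasiMeasurePreserving.ae hs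
    have hsum : ∫ y, (∑ i : Fin (n + 1), ∑ j ∈ Finset.univ.erase i, G (y i) (y j)) ∂μ
        = ((n : ℝ) + 1) * (n * I) := by
      rw [integral_finsetSum _ fun i _ => integrable_finsetSum _ fun j hj =>
        hint i j (Finset.ne_of_mem_erase hj).symm]
      have : ∀ i : Fin (n + 1),
          ∫ y, (∑ j ∈ Finset.univ.erase i, G (y i) (y j)) ∂μ = n * I := fun i => by
        rw [integral_finsetSum _ fun j hj => hint i j (Finset.ne_of_mem_erase hj).symm,
          Finset.sum_congr rfl fun j hj => hval i j (Finset.ne_of_mem_erase hj).symm]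
        simp
      simp only [this]
      simp
    -- The diagonal is bounded pointwise and never integrated: measurability of `G` up to null sets
    -- of the product says nothing about it.
    have hlow : ∀ᵐ y ∂μ, -(((n : ℝ) + 1) * M)
        ≤ ∑ i : Fin (n + 1), ∑ j ∈ Finset.univ.erase i, G (y i) (y j) := by
      filter_upwards [hmem] with y hy
      have h0 := hpos (n + 1) y hy
      have h1 : ∑ i, ∑ j, G (y i) (y j) = ∑ i, G (y i) (y i)
          + ∑ i, ∑ j ∈ Finset.univ.erase i, G (y i) (y j) := by
        rw [← Finset.sum_add_distrib]
        exact Finset.sum_congr rfl fun i _ => (Finset.add_sum_erase _ _ (Finset.mem_univ i)).symm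
      have h2 : ∑ i, G (y i) (y i) ≤ ((n : ℝ) + 1) * M := by
        refine (Finset.sum_le_sum fun i _ => hdiag (y i) (hy i)).trans_eq ?_
        simp
      linarith
    have := integral_mono_ae (μ := μ) (integrable_const (-(((n : ℝ) + 1) * M)))
      (integrable_finsetSum _ fun i _ => integrable_finsetSum _ fun j hj =>
        hint i j (Finset.ne_of_mem_erase hj).symm) hlow
    rw [hsum] at this
    simp at this
    linarith
  by_contra! hneg
  obtain ⟨n, hn⟩ := exists_nat_gt (M / -I)
  rw [div_lt_iff₀ (by linarith)] at hn
  have h1 := key n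
  rw [← mul_add] at h1
  have h2 : 0 ≤ M + n * I := nonneg_of_mul_nonneg_right h1 (by positivity)
  linarith

theorem abs_translationKernel_le {d : ℕ} {κ : Rn d → ℝ} [IsPosDefKernel (translationKernel κ)]
    (z : Rn d) : |κ z| ≤ κ 0 := by
  simpa using abs_sum_translate_le (κ := κ) (fun _ : Unit => (0 : Rn d)) (fun _ => 1) z

/-! ### Energy estimates by duality -/

namespace FourierBounds

variable {d : ℕ} {κ : Rn d → ℝ} {m : ℕ} {c₁ c₂ : ℝ} {Ω : Set (Rn d)}

/-- The energy of an integrable density with respect to the kernel, on the Fourier side. -/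
theorem integral_mul_integral_mul (h : FourierBounds κ m c₁ c₂) {g : Rn d → ℝ}
    (hg : Integrable g) :
    ∫ x, g x * ∫ y, g y * κ (x - y) = ∫ ξ, (realFourier κ ξ).re * ‖realFourier g ξ‖ ^ 2 := by
  apply Complex.ofReal_injective
  rw [← integral_complex_ofReal, ← integral_complex_ofReal]
  have e := integral_integral_mul_fourierVersion h.integrable_fourier hg
  refine Eq.trans ?_ (e.trans ?_)
  · refine integral_congr_ae (.of_forall fun x => ?_)
    simp only [Complex.ofReal_mul]
    rw [← integral_complex_ofReal]
    congr 1
    have hae : ∀ᵐ y, (κ (x - y) : ℂ) = fourierVersion κ (x - y) :=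
      (quasiMeasurePreserving_sub_left volume x).ae
        (ae_eq_fourierVersion h.integrable h.integrable_fourier)
    refine integral_congr_ae ?_
    filter_upwards [hae] with y hy
    rw [Complex.ofReal_mul, hy]
  · refine integral_congr_ae (.of_forall fun ξ => ?_)
    simp only
    rw [Complex.ofReal_mul, h.ofReal_re]

/-- Pairing an element of the reproducing kernel Hilbert space with a test function. -/
theorem sq_integral_mul_le [IsPosDefKernel (translationKernel κ)]
    (h : FourierBounds κ m c₁ c₂) {φ g : Rn d → ℝ} (hφ : IsTestFunction Ω φ)
    (hg : IsTestFunction Ω g) (u : RKHSOn (translationKernel κ) Ω)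
    (hu : ∀ x : Ω, u x = φ x) :
    (∫ x, φ x * g x) ^ 2
      ≤ ‖u‖ ^ 2 * ∫ ξ, (realFourier κ ξ).re * ‖realFourier g ξ‖ ^ 2 := by
  set K := tsupport g
  have hK0 : ∀ x, x ∉ K → g x = 0 := fun x hx => image_eq_zero_of_notMem_tsupport hx
  by_cases hV : volume K = 0
  · have hz : ∫ x, φ x * g x = 0 := by
      refine integral_eq_zero_of_ae ?_
      filter_upwards [measure_eq_zero_iff_ae_notMem.1 hV] with x hx
      simp [hK0 x hx]
    rw [hz, zero_pow two_ne_zero]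
    exact mul_nonneg (sq_nonneg _) (integral_nonneg fun ξ =>
      mul_nonneg (h.re_nonneg ξ) (sq_nonneg _))
  have hVt : volume K ≠ ⊤ := hg.compact_support.isCompact.measure_lt_top.ne
  -- Sampling is uniform on the support of `g`, which lies in `Ω`, where `u` can be evaluated.
  let ν : Measure (Rn d) := (volume K)⁻¹ • volume.restrict K
  have hν : IsProbabilityMeasure ν := ⟨by
    simp only [ν, Measure.smul_apply, Measure.restrict_apply_univ, smul_eq_mul]
    exact ENNReal.inv_mul_cancel hV hVt⟩
  have hνac : ν ≪ volume :=
    (Measure.smul_absolutelyContinuous).trans Measure.restrict_le_self.absolutelyContinuous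
  -- By Cauchy–Schwarz in the Hilbert space, `‖u‖² k - u ⊗ u` is positive semidefinite on `Ω`;
  -- weighting it by `g ⊗ g` and averaging gives the claim.
  let G : Rn d → Rn d → ℝ := fun x y => (‖u‖ ^ 2 * κ (x - y) - φ x * φ y) * (g x * g y)
  obtain ⟨B, hB⟩ := hg.compact_support.exists_bound_of_continuous hg.continuous
  obtain ⟨A, hA⟩ := hφ.compact_support.exists_bound_of_continuous hφ.continuous
  have hκ0 : 0 ≤ κ 0 := (abs_nonneg _).trans (abs_translationKernel_le 0)
  have hB0 : 0 ≤ B := (norm_nonneg _).trans (hB 0)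
  have hA0 : 0 ≤ A := (norm_nonneg _).trans (hA 0)
  have hκm : AEStronglyMeasurable (fun p : Rn d × Rn d => κ (p.1 - p.2))
      (volume.prod volume) :=
    h.integrable.aestronglyMeasurable.comp_quasiMeasurePreserving
      (quasiMeasurePreserving_sub_of_right_invariant volume volume)
  have hφc := hφ.continuous
  have hgc := hg.continuous
  have hGm : AEStronglyMeasurable (fun p : Rn d × Rn d => G p.1 p.2) (volume.prod volume) := by
    refine ((hκm.const_mul _).sub ?_).mul ?_ <;>
      exact Continuous.aestronglyMeasurable (by fun_prop)
  have hGi : Integrable (fun p : Rn d × Rn d => G p.1 p.2) (ν.prod ν) := by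
    refine Integrable.of_bound (hGm.mono_ac (hνac.prod hνac))
      ((‖u‖ ^ 2 * κ 0 + A * A) * (B * B)) (.of_forall fun p => ?_)
    simp only [G, norm_mul]
    gcongr
    · refine (norm_sub_le _ _).trans ?_
      rw [norm_mul, norm_mul, Real.norm_of_nonneg (sq_nonneg ‖u‖)]
      gcongr
      · exact abs_translationKernel_le _
      · exact hA _
      · exact hA _
    · exact hB _
    · exact hB _
  have hmem : ∀ᵐ y ∂ν, y ∈ Ω := by
    refine Measure.ae_smul_measure ?_ _
    filter_upwards [ae_restrict_mem (isClosed_tsupport g).measurableSet] with y hy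
    exact hg.support_subset hy
  have hmean : 0 ≤ ∫ p, G p.1 p.2 ∂(ν.prod ν) := by
    refine integral_prod_nonneg_of_sum_nonneg ν hGi hmem (M := ‖u‖ ^ 2 * κ 0 * (B * B)) ?_ ?_
    · intro y _
      simp only [G, sub_self]
      have h1 : g y * g y ≤ B * B := by
        rw [← abs_mul_abs_self (g y)]
        have := hB y
        rw [Real.norm_eq_abs] at this
        gcongr
      have h2 : ‖u‖ ^ 2 * κ 0 * (g y * g y) ≤ ‖u‖ ^ 2 * κ 0 * (B * B) := by gcongr
      nlinarith [mul_nonneg (mul_self_nonneg (φ y)) (mul_self_nonneg (g y))]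
    · intro n y hy
      have h1 := sq_sum_mul_apply_le Finset.univ (fun i => (⟨y i, hy i⟩ : Ω))
        (fun i => g (y i)) u
      simp only [hu, translationKernel] at h1
      have h2 : ∑ i, ∑ j, G (y i) (y j) = ‖u‖ ^ 2 * (∑ i, ∑ j, g (y i) * g (y j)
          * κ (y i - y j)) - (∑ i, g (y i) * φ (y i)) ^ 2 := by
        rw [sq (∑ i, _), Finset.sum_mul_sum, Finset.mul_sum, ← Finset.sum_sub_distrib]
        refine Finset.sum_congr rfl fun i _ => ?_
        rw [Finset.mul_sum, ← Finset.sum_sub_distrib]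
        refine Finset.sum_congr rfl fun j _ => ?_
        simp only [G]
        ring
      rw [h2]
      linarith
  have hmean' : 0 ≤ ∫ x, ∫ y, G x y := by
    rw [integral_prod _ hGi] at hmean
    simp only [ν, integral_smul_measure, smul_eq_mul, integral_const_mul] at hmean
    have hr : 0 < ((volume K)⁻¹).toReal :=
      ENNReal.toReal_pos (ENNReal.inv_ne_zero.2 hVt) (ENNReal.inv_ne_top.2 hV)
    have h1 := nonneg_of_mul_nonneg_right (nonneg_of_mul_nonneg_right hmean hr) hr
    have h2 : ∀ x, ∫ y in K, G x y = ∫ y, G x y := fun x =>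
      setIntegral_eq_integral_of_forall_compl_eq_zero fun y hy => by simp [G, hK0 y hy]
    simp only [h2] at h1
    rwa [setIntegral_eq_integral_of_forall_compl_eq_zero fun x hx => by
      simp [G, hK0 x hx]] at h1
  have hinner : ∀ x, ∫ y, G x y
      = ‖u‖ ^ 2 * (g x * ∫ y, g y * κ (x - y)) - (φ x * g x) * ∫ y, φ y * g y := by
    intro x
    have i1 : Integrable fun y => g y * κ (x - y) :=
      (h.integrable.comp_sub_left x).bdd_mul hgc.aestronglyMeasurable (.of_forall hB)
    rw [← integral_const_mul, ← integral_const_mul, ← integral_const_mul, ← integral_sub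
      ((i1.const_mul _).const_mul _) ((hφ.mul_integrable hgc).const_mul _)]
    refine integral_congr_ae (.of_forall fun y => ?_)
    simp only [G]
    ring
  have hconv : Integrable fun x => g x * ∫ y, g y * κ (x - y) := by
    have h1 : Integrable fun x => ∫ y, g y * κ (x - y) :=
      hg.integrable.integrable_convolution (ContinuousLinearMap.mul ℝ ℝ) h.integrable
    exact h1.bdd_mul hgc.aestronglyMeasurable (.of_forall hB)
  simp only [hinner] at hmean'
  rw [integral_sub (hconv.const_mul _) ((hφ.mul_integrable hgc).mul_const _),
    integral_const_mul, integral_mul_const, h.integral_mul_integral_mul hg.integrable] at hmean'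
  rw [sq]
  linarith

end FourierBounds

/-- The elliptic operator with symbol `(-1)^m seminormSymbol m`, applied to a test function. -/
theorem IsTestFunction.exists_fourier_eq_symbol_mul {d : ℕ} {Ω : Set (Rn d)} {φ : Rn d → ℝ}
    (hφ : IsTestFunction Ω φ) (m : ℕ) : ∃ g : Rn d → ℝ, IsTestFunction Ω g ∧
      ∀ ξ, realFourier g ξ = (-1) ^ m * seminormSymbol m ξ * realFourier φ ξ := by
  have key : ∀ s : Finset (Fin d → ℕ), (∀ α ∈ s, ∑ i, α i = m) →
      ∃ g : Rn d → ℝ, IsTestFunction Ω g ∧ ∀ ξ, realFourier g ξ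
        = (-1) ^ m * ((∑ α ∈ s, ∏ i, ((2 * Real.pi * ξ i) ^ 2) ^ α i : ℝ) : ℂ)
          * realFourier φ ξ := by
    classical
    intro s
    induction s using Finset.induction_on with
    | empty =>
      intro _
      refine ⟨fun _ => 0, ⟨contDiff_const, HasCompactSupport.zero, ?_⟩, fun ξ => ?_⟩
      · rw [show (fun _ : Rn d => (0 : ℝ)) = 0 from rfl, tsupport_zero]; exact Set.empty_subset _
      · simp [realFourier, Real.fourier_eq]
    | insert α s hα ih =>
      intro hs
      obtain ⟨g, hg, hgf⟩ := ih fun β hβ => hs β (Finset.mem_insert_of_mem hβ)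
      -- The operator is `∑ D^α D^α` over `|α| = m`: each term has symbol `(-1)^m ∏ (2π ξ_j)^{2
      -- α_j}`, with a sign independent of `α`.
      have hD := (hφ.multiDeriv α).multiDeriv α
      refine ⟨_, hD.add hg, fun ξ => ?_⟩
      have hadd : realFourier (fun x => _root_.multiDeriv α (_root_.multiDeriv α φ) x + g x) ξ
          = realFourier (_root_.multiDeriv α (_root_.multiDeriv α φ)) ξ + realFourier g ξ := by
        rw [← (hD.add hg).fourier_toSchwartz, ← hD.fourier_toSchwartz, ← hg.fourier_toSchwartz,
          ← add_apply, ← FourierTransform.fourier_add]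
        congr 2
        ext x
        simp
      rw [hadd, hgf, (hφ.multiDeriv α).fourier_multiDeriv, hφ.fourier_multiDeriv,
        Finset.sum_insert hα, ← mul_assoc, ← Finset.prod_mul_distrib]
      have h1 : ∏ i, ((2 * Real.pi * Complex.I * (ξ i : ℝ)) ^ α i
          * (2 * Real.pi * Complex.I * (ξ i : ℝ)) ^ α i)
          = (-1) ^ m * ((∏ i, ((2 * Real.pi * ξ i) ^ 2) ^ α i : ℝ) : ℂ) := by
        rw [← hs α (Finset.mem_insert_self α s), ← Finset.prod_pow_eq_pow_sum]
        push_cast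
        rw [← Finset.prod_mul_distrib]
        refine Finset.prod_congr rfl fun i _ => ?_
        rw [← mul_pow, ← mul_pow]
        congr 1
        linear_combination (2 * Real.pi * (ξ i : ℂ)) ^ 2 * Complex.I_sq
      rw [h1]
      push_cast
      ring
  exact key _ fun α hα => (Finset.mem_piAntidiag.1 hα).1

/-! ### The two norm bounds for test functions -/

namespace FourierBounds

variable {d : ℕ} {κ : Rn d → ℝ} {m : ℕ} {c₁ c₂ : ℝ} {Ω : Set (Rn d)}

/-- The seminorm of a test function is controlled by its norm in the reproducing kernel Hilbert
space. -/
theorem integral_symbol_mul_le [IsPosDefKernel (translationKernel κ)]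
    (h : FourierBounds κ m c₁ c₂) {φ : Rn d → ℝ} (hφ : IsTestFunction Ω φ)
    (u : RKHSOn (translationKernel κ) Ω) (hu : ∀ x : Ω, u x = φ x) :
    ∫ ξ, seminormSymbol m ξ * ‖realFourier φ ξ‖ ^ 2 ≤ c₂ * ‖u‖ ^ 2 := by
  obtain ⟨g, hg, hgf⟩ := hφ.exists_fourier_eq_symbol_mul m
  set N := ∫ ξ, seminormSymbol m ξ * ‖realFourier φ ξ‖ ^ 2
  have hN : 0 ≤ N := integral_nonneg fun ξ =>
    mul_nonneg (seminormSymbol_nonneg m ξ) (sq_nonneg _)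
  have h1 : (∫ x, φ x * g x) = (-1) ^ m * N := by
    apply Complex.ofReal_injective
    rw [← hφ.integral_conj_fourier_mul hg]
    push_cast
    rw [← integral_complex_ofReal, ← integral_const_mul]
    refine integral_congr_ae (.of_forall fun ξ => ?_)
    simp only [hgf]
    push_cast
    rw [← Complex.conj_mul']
    ring
  have h2 := h.sq_integral_mul_le hφ hg u hu
  have h3 : ∫ ξ, (realFourier κ ξ).re * ‖realFourier g ξ‖ ^ 2 ≤ c₂ * N := by
    rw [← integral_const_mul]
    refine integral_mono_of_nonneg (.of_forall fun ξ => mul_nonneg (h.re_nonneg ξ) (sq_nonneg _))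
      ((hφ.integrable_symbol_mul m).const_mul _) (.of_forall fun ξ => ?_)
    have hP := seminormSymbol_nonneg m ξ
    have hn : ‖realFourier g ξ‖ ^ 2 = seminormSymbol m ξ ^ 2 * ‖realFourier φ ξ‖ ^ 2 := by
      rw [hgf, norm_mul, norm_mul, Complex.norm_real, mul_pow, mul_pow, Real.norm_of_nonneg hP]
      simp
    have hw : decayWeight m ξ * seminormSymbol m ξ ≤ 1 := by
      rw [decayWeight, inv_mul_le_one₀ (by positivity)]
      refine (seminormSymbol_le m ξ).trans ?_
      rw [norm_smul, Real.norm_of_nonneg (by positivity : 0 ≤ 2 * Real.pi)]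
      gcongr
      linarith
    simp only [hn]
    calc _ ≤ c₂ * decayWeight m ξ * (seminormSymbol m ξ ^ 2 * ‖realFourier φ ξ‖ ^ 2) := by
          gcongr; exact h.upper ξ
      _ = c₂ * (decayWeight m ξ * seminormSymbol m ξ)
          * (seminormSymbol m ξ * ‖realFourier φ ξ‖ ^ 2) := by ring
      _ ≤ c₂ * 1 * (seminormSymbol m ξ * ‖realFourier φ ξ‖ ^ 2) := by
          have := h.pos₂.le
          gcongr
      _ = _ := by ring
  rw [h1, mul_pow, ← pow_mul, mul_comm m, pow_mul, neg_one_sq, one_pow, one_mul] at h2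
  have h4 : N ^ 2 ≤ ‖u‖ ^ 2 * (c₂ * N) := h2.trans (by gcongr)
  -- The estimate `N² ≤ c₂ ‖u‖² N` is divided by `N`.
  rcases hN.eq_or_lt with h0 | h0
  · rw [← h0]; exact mul_nonneg h.pos₂.le (sq_nonneg _)
  · refine le_of_mul_le_mul_right ?_ h0
    nlinarith

/-- A test function belongs to the reproducing kernel Hilbert space, and its norm there is
controlled by its Sobolev seminorm on a set of finite width. -/
theorem exists_rkhs_of_isTestFunction [IsPosDefKernel (translationKernel κ)]
    (h : FourierBounds κ m c₁ c₂) (hΩ : HasFiniteWidth Ω) :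
    ∃ C : ℝ, 0 < C ∧ ∀ φ : Rn d → ℝ, IsTestFunction Ω φ →
      ∃ u : RKHSOn (translationKernel κ) Ω, (∀ x : Ω, u x = φ x) ∧
        ‖u‖ ≤ C * Real.sqrt (∫ ξ, seminormSymbol m ξ * ‖realFourier φ ξ‖ ^ 2) := by
  obtain ⟨C, hC, hCφ⟩ := IsTestFunction.integral_weight_mul_fourier_le hΩ m
  have hc := h.pos₁
  -- `C + 1` instead of `C`, which may vanish, keeps the constant positive.
  refine ⟨Real.sqrt (c₁⁻¹ * (C + 1)), by positivity, fun φ hφ => ?_⟩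
  have hN : 0 ≤ ∫ ξ, seminormSymbol m ξ * ‖realFourier φ ξ‖ ^ 2 := integral_nonneg fun ξ =>
    mul_nonneg (seminormSymbol_nonneg m ξ) (sq_nonneg _)
  obtain ⟨u, hu, hun⟩ := exists_coe_eq_of_sq_sum_le (k := translationKernel κ) (Ω := Ω)
    (fun x => φ x) (C := Real.sqrt (c₁⁻¹ * (C + 1))
      * Real.sqrt (∫ ξ, seminormSymbol m ξ * ‖realFourier φ ξ‖ ^ 2)) (by positivity) (by
    intro s c
    have h1 := h.sq_sum_mul_le hφ (fun x : s => ((x : Ω) : Rn d)) (fun x => c x)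
    have h2 := IsPosDefKernel.sum_nonneg (translationKernel κ)
      (fun x : s => ((x : Ω) : Rn d)) (fun x => c x)
    simp only [translationKernel] at h2 ⊢
    simp only [Finset.sum_coe_sort s fun x => c x * φ x] at h1
    have e : ∑ i : s, ∑ j : s, c i * c j * κ (((i : Ω) : Rn d) - ((j : Ω) : Rn d))
        = ∑ x ∈ s, ∑ y ∈ s, c x * c y * κ ((x : Rn d) - y) := by
      rw [← Finset.sum_coe_sort s fun x => ∑ y ∈ s, c x * c y * κ ((x : Rn d) - y)]
      exact Finset.sum_congr rfl fun x _ =>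
        Finset.sum_coe_sort s fun y => c x * c y * κ (((x : Ω) : Rn d) - y)
    rw [e] at h1 h2
    refine h1.trans (mul_le_mul_of_nonneg_right ?_ h2)
    rw [mul_pow, Real.sq_sqrt (by positivity), Real.sq_sqrt hN, mul_assoc]
    gcongr
    refine (hCφ φ hφ).trans ?_
    gcongr
    linarith)
  exact ⟨u, fun x => congrFun hu x, hun⟩

end FourierBounds

/-! ### Weak derivatives and the Sobolev seminorm -/

section Weak

variable {d : ℕ} {Ω : Set (Rn d)} {α : Fin d → ℕ}

theorem IsTestFunction.integrable_mul_of_locallyIntegrableOn {φ f : Rn d → ℝ}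
    (hφ : IsTestFunction Ω φ) (hf : LocallyIntegrableOn f Ω) :
    Integrable fun x => f x * φ x := by
  have h1 : IntegrableOn f (tsupport φ) :=
    hf.integrableOn_compact_subset hφ.support_subset hφ.compact_support.isCompact
  obtain ⟨B, hB⟩ := hφ.compact_support.exists_bound_of_continuous hφ.continuous
  have h2 : IntegrableOn (fun x => f x * φ x) (tsupport φ) :=
    h1.mul_bdd hφ.continuous.aestronglyMeasurable (.of_forall hB)
  refine (integrableOn_iff_integrable_of_support_subset fun x hx => ?_).1 h2
  exact subset_tsupport φ (right_ne_zero_of_mul hx)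

/-- The fundamental lemma of the calculus of variations; it makes the choice in `weakDeriv`
immaterial to the norms. -/
theorem HasWeakDeriv.ae_eq {f g g' : Rn d → ℝ} (hΩ : IsOpen Ω) (h : HasWeakDeriv Ω α f g)
    (h' : HasWeakDeriv Ω α f g') : g =ᵐ[volume.restrict Ω] g' := by
  have hz : ∀ᵐ x, x ∈ Ω → g x - g' x = 0 := by
    refine hΩ.ae_eq_zero_of_integral_contDiff_smul_eq_zero
      (h.locallyIntegrable_right.sub h'.locallyIntegrable_right) fun ψ h1 h2 h3 => ?_
    have hψ : IsTestFunction Ω ψ := ⟨h1, h2, h3⟩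
    have e := (h.integral_eq ψ hψ).symm.trans (h'.integral_eq ψ hψ)
    have e' := mul_left_cancel₀ (pow_ne_zero _ (by norm_num)) e
    rw [hψ.setIntegral_mul, hψ.setIntegral_mul] at e'
    rw [← sub_eq_zero, ← integral_sub
      (hψ.integrable_mul_of_locallyIntegrableOn h.locallyIntegrable_right)
      (hψ.integrable_mul_of_locallyIntegrableOn h'.locallyIntegrable_right)] at e'
    rw [← e']
    refine integral_congr_ae (.of_forall fun x => ?_)
    simp only [smul_eq_mul]
    ring
  filter_upwards [(ae_restrict_iff' hΩ.measurableSet).2 hz] with x hx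
  exact sub_eq_zero.1 hx

theorem HasWeakDeriv.sub {f₁ f₂ g₁ g₂ : Rn d → ℝ} (h₁ : HasWeakDeriv Ω α f₁ g₁)
    (h₂ : HasWeakDeriv Ω α f₂ g₂) : HasWeakDeriv Ω α (f₁ - f₂) (g₁ - g₂) where
  locallyIntegrable_left := h₁.locallyIntegrable_left.sub h₂.locallyIntegrable_left
  locallyIntegrable_right := h₁.locallyIntegrable_right.sub h₂.locallyIntegrable_right
  integral_eq ψ hψ := by
    have hD := hψ.multiDeriv α
    simp only [Pi.sub_apply, sub_mul]
    rw [integral_sub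
      (hD.integrable_mul_of_locallyIntegrableOn h₁.locallyIntegrable_left).integrableOn
      (hD.integrable_mul_of_locallyIntegrableOn h₂.locallyIntegrable_left).integrableOn,
      integral_sub
      (hψ.integrable_mul_of_locallyIntegrableOn h₁.locallyIntegrable_right).integrableOn
      (hψ.integrable_mul_of_locallyIntegrableOn h₂.locallyIntegrable_right).integrableOn,
      h₁.integral_eq ψ hψ, h₂.integral_eq ψ hψ]
    ring

theorem HasWeakDeriv.weakDeriv_ae_eq {f g : Rn d → ℝ} (hΩ : IsOpen Ω)
    (h : HasWeakDeriv Ω α f g) : weakDeriv Ω α f =ᵐ[volume.restrict Ω] g := by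
  have hex : ∃ g, HasWeakDeriv Ω α f g := ⟨g, h⟩
  rw [weakDeriv, dif_pos hex]
  exact hex.choose_spec.ae_eq hΩ h

theorem multiDeriv_zero (φ : Rn d → ℝ) : multiDeriv 0 φ = φ := by
  rw [multiDeriv]
  induction List.finRange d with
  | nil => rfl
  | cons i l ih => exact ih

theorem HasWeakDeriv.zero {f : Rn d → ℝ} (hf : LocallyIntegrableOn f Ω) :
    HasWeakDeriv Ω 0 f f where
  locallyIntegrable_left := hf
  locallyIntegrable_right := hf
  integral_eq ψ _ := by simp [multiDeriv_zero]

variable {m : ℕ} {f g : Rn d → ℝ}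

theorem MemSobolev.hasWeakDeriv_weakDeriv (hf : MemSobolev Ω m f) (hα : ∑ i, α i ≤ m) :
    HasWeakDeriv Ω α f (weakDeriv Ω α f) := by
  have hex : ∃ g, HasWeakDeriv Ω α f g := (hf.2 α hα).imp fun _ h => h.1
  rw [weakDeriv, dif_pos hex]
  exact hex.choose_spec

theorem MemSobolev.memLp_weakDeriv (hΩ : IsOpen Ω) (hf : MemSobolev Ω m f)
    (hα : ∑ i, α i ≤ m) : MemLp (weakDeriv Ω α f) 2 (volume.restrict Ω) := by
  obtain ⟨g, hg, hg2⟩ := hf.2 α hα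
  exact hg2.ae_eq (hg.weakDeriv_ae_eq hΩ).symm

theorem MemSobolev.sub (hf : MemSobolev Ω m f) (hg : MemSobolev Ω m g) :
    MemSobolev Ω m (f - g) := by
  refine ⟨hf.1.sub hg.1, fun α hα => ?_⟩
  obtain ⟨f', h1, h2⟩ := hf.2 α hα
  obtain ⟨g', h3, h4⟩ := hg.2 α hα
  exact ⟨f' - g', h1.sub h3, h2.sub h4⟩

theorem IsTestFunction.memSobolev {φ : Rn d → ℝ} (hφ : IsTestFunction Ω φ) (m : ℕ) :
    MemSobolev Ω m φ :=
  ⟨(hφ.continuous.memLp_of_hasCompactSupport hφ.compact_support).restrict Ω, fun α _ =>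
    ⟨_, hφ.hasWeakDeriv α, ((hφ.multiDeriv α).continuous.memLp_of_hasCompactSupport
      (hφ.multiDeriv α).compact_support).restrict Ω⟩⟩

theorem IsTestFunction.sobolevSeminorm_eq {φ : Rn d → ℝ} (hΩ : IsOpen Ω)
    (hφ : IsTestFunction Ω φ) (m : ℕ) : sobolevSeminorm Ω m φ
      = Real.sqrt (∫ ξ, seminormSymbol m ξ * ‖realFourier φ ξ‖ ^ 2) := by
  rw [sobolevSeminorm, ← hφ.sum_integral_multiDeriv_sq]
  congr 1
  refine Finset.sum_congr rfl fun α _ => ?_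
  rw [← (hφ.multiDeriv α).setIntegral_sq]
  refine integral_congr_ae ?_
  filter_upwards [(hφ.hasWeakDeriv α).weakDeriv_ae_eq hΩ] with x hx
  rw [hx]

/-- Minkowski's inequality for a finite family; Cauchy–Schwarz for the cross term comes from the
discriminant of a nonnegative quadratic in `t`. -/
theorem sqrt_sum_integral_add_sq_le {ι Y : Type*} [MeasurableSpace Y] {μ : Measure Y}
    (s : Finset ι) {a b : ι → Y → ℝ} (ha : ∀ i ∈ s, MemLp (a i) 2 μ)
    (hb : ∀ i ∈ s, MemLp (b i) 2 μ) :
    Real.sqrt (∑ i ∈ s, ∫ x, (a i x + b i x) ^ 2 ∂μ)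
      ≤ Real.sqrt (∑ i ∈ s, ∫ x, a i x ^ 2 ∂μ) + Real.sqrt (∑ i ∈ s, ∫ x, b i x ^ 2 ∂μ) := by
  set A := ∑ i ∈ s, ∫ x, a i x ^ 2 ∂μ
  set B := ∑ i ∈ s, ∫ x, b i x ^ 2 ∂μ
  set D := ∑ i ∈ s, ∫ x, a i x * b i x ∂μ
  have hA : 0 ≤ A := Finset.sum_nonneg fun i _ => integral_nonneg fun x => sq_nonneg _
  have hB : 0 ≤ B := Finset.sum_nonneg fun i _ => integral_nonneg fun x => sq_nonneg _
  have hexp : ∀ t : ℝ, ∑ i ∈ s, ∫ x, (a i x + t * b i x) ^ 2 ∂μ = B * (t * t) + 2 * D * t + A := by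
    intro t
    simp only [A, B, D, Finset.mul_sum, Finset.sum_mul, ← Finset.sum_add_distrib]
    refine Finset.sum_congr rfl fun i hi => ?_
    have i1 := (ha i hi).integrable_sq
    have i2 := (hb i hi).integrable_sq
    have i3 : Integrable (fun x => a i x * b i x) μ := (ha i hi).integrable_mul (hb i hi)
    have e : ∀ x, (a i x + t * b i x) ^ 2 = t * t * b i x ^ 2 + 2 * t * (a i x * b i x) + a i x ^ 2 :=
      fun x => by ring
    simp only [e]
    have i4 : Integrable (fun x => t * t * b i x ^ 2 + 2 * t * (a i x * b i x)) μ :=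
      (i2.const_mul _).add (i3.const_mul _)
    rw [integral_add i4 i1, integral_add (i2.const_mul _) (i3.const_mul _),
      integral_const_mul, integral_const_mul]
    ring
  have hdisc := discrim_le_zero fun t => (Finset.sum_nonneg fun i _ =>
    integral_nonneg fun x => sq_nonneg _).trans_eq (hexp t)
  rw [discrim] at hdisc
  have hD : D ≤ Real.sqrt A * Real.sqrt B := by
    rw [← Real.sqrt_mul hA]
    exact Real.le_sqrt_of_sq_le (by nlinarith)
  have h1 := hexp 1
  simp only [one_mul, mul_one] at h1
  rw [h1, Real.sqrt_le_iff]
  refine ⟨by positivity, ?_⟩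
  rw [add_sq, Real.sq_sqrt hA, Real.sq_sqrt hB]
  linarith

theorem MemSobolev.sobolevSeminorm_le (hΩ : IsOpen Ω) (hf : MemSobolev Ω m f)
    (hg : MemSobolev Ω m g) :
    sobolevSeminorm Ω m f ≤ sobolevSeminorm Ω m (f - g) + sobolevSeminorm Ω m g := by
  have hfg := hf.sub hg
  have hα : ∀ α ∈ Finset.piAntidiag (Finset.univ : Finset (Fin d)) m, ∑ i, α i ≤ m :=
    fun α h => (Finset.mem_piAntidiag.1 h).1.le
  refine le_of_eq_of_le ?_ (sqrt_sum_integral_add_sq_le (μ := volume.restrict Ω)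
    (Finset.piAntidiag Finset.univ m) (fun α h => hfg.memLp_weakDeriv hΩ (hα α h))
    (fun α h => hg.memLp_weakDeriv hΩ (hα α h)))
  rw [sobolevSeminorm]
  congr 1
  refine Finset.sum_congr rfl fun α h => integral_congr_ae ?_
  filter_upwards [((hf.hasWeakDeriv_weakDeriv (hα α h)).sub
    (hg.hasWeakDeriv_weakDeriv (hα α h))).weakDeriv_ae_eq hΩ] with x hx
  rw [hx, Pi.sub_apply, sub_add_cancel]

theorem MemSobolev.sobolevSeminorm_sub_comm (hΩ : IsOpen Ω) (hf : MemSobolev Ω m f)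
    (hg : MemSobolev Ω m g) : sobolevSeminorm Ω m (f - g) = sobolevSeminorm Ω m (g - f) := by
  rw [sobolevSeminorm, sobolevSeminorm]
  congr 1
  refine Finset.sum_congr rfl fun α h => integral_congr_ae ?_
  have hα := (Finset.mem_piAntidiag.1 h).1.le
  filter_upwards [((hf.hasWeakDeriv_weakDeriv hα).sub
    (hg.hasWeakDeriv_weakDeriv hα)).weakDeriv_ae_eq hΩ, ((hg.hasWeakDeriv_weakDeriv hα).sub
    (hf.hasWeakDeriv_weakDeriv hα)).weakDeriv_ae_eq hΩ] with x h1 h2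
  rw [h1, h2, Pi.sub_apply, Pi.sub_apply]
  ring

theorem sum_integral_weakDeriv_nonneg (Ω : Set (Rn d)) (j : ℕ) (f : Rn d → ℝ) :
    0 ≤ ∑ α ∈ Finset.piAntidiag Finset.univ j, ∫ x in Ω, (weakDeriv Ω α f x) ^ 2 :=
  Finset.sum_nonneg fun _ _ => integral_nonneg fun _ => sq_nonneg _

theorem sobolevSeminorm_le_sobolevNorm {j : ℕ} (hj : j ≤ m) (f : Rn d → ℝ) :
    sobolevSeminorm Ω j f ≤ sobolevNorm Ω m f :=
  Real.sqrt_le_sqrt (Finset.single_le_sum (f := fun j =>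
    ∑ α ∈ Finset.piAntidiag Finset.univ j, ∫ x in Ω, (weakDeriv Ω α f x) ^ 2)
    (fun j _ => sum_integral_weakDeriv_nonneg Ω j f) (Finset.mem_range.2 (by omega)))

theorem MemSobolev.sobolevSeminorm_zero (hΩ : IsOpen Ω) (hf : MemSobolev Ω m f) :
    sobolevSeminorm Ω 0 f = Real.sqrt (∫ x in Ω, f x ^ 2) := by
  have h0 := (hf.hasWeakDeriv_weakDeriv (α := 0) (by simp)).locallyIntegrable_left
  rw [sobolevSeminorm, Finset.piAntidiag_zero, Finset.sum_singleton]
  congr 1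
  refine integral_congr_ae ?_
  filter_upwards [(HasWeakDeriv.zero h0).weakDeriv_ae_eq hΩ] with x hx
  rw [hx]

end Weak

/-! ### Passage to the closure -/

theorem norm_kerFun_translationKernel_le {d : ℕ} (κ : Rn d → ℝ)
    [IsPosDefKernel (translationKernel κ)] {Ω : Set (Rn d)} (x : Ω) :
    ‖RKHS.kerFun (RKHSOn (translationKernel κ) Ω) x‖ ≤ Real.sqrt |κ 0| := by
  rw [RKHS.norm_kerFun_eq_sqrt_norm_kernel, RKHS.OfKernel.kernel_ofKernel]
  refine Real.sqrt_le_sqrt ?_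
  simp [kernelMatrix, translationKernel, norm_smul]

theorem lemma2 {d m : ℕ} (hm : 0 < m) (hdm : (d : ℝ) / 2 < m)
    (Ω : Set (Rn d)) (hΩ : IsOpen Ω) (hΩ_lip : HasLipschitzBoundary Ω)
    (hΩ_width : HasFiniteWidth Ω)
    (κ : Rn d → ℝ) (hκ_int : Integrable κ) [hκ_pd : IsPosDefKernel (translationKernel κ)]
    (hκ_decay : HasFourierDecay κ m) :
    ∃ c_l c_u : ℝ, 0 < c_l ∧ c_l < c_u ∧
      ∀ f : Rn d → ℝ, MemSobolevZero Ω m f →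
        ∃ h : RKHSOn (translationKernel κ) Ω,
          Continuous (h : Ω → ℝ) ∧ (∀ᵐ x : Rn d, ∀ hx : x ∈ Ω, h ⟨x, hx⟩ = f x) ∧
          c_l * sobolevSeminorm Ω m f ≤ ‖h‖ ∧ ‖h‖ ≤ c_u * sobolevSeminorm Ω m f := by

  obtain ⟨c₁, c₂, hκ⟩ := hκ_decay.exists_fourierBounds hdm hκ_int
  obtain ⟨C, hC, hCφ⟩ := hκ.exists_rkhs_of_isTestFunction hΩ_width
  have hc₂ := hκ.pos₂
  have hcl : 0 < (Real.sqrt c₂)⁻¹ := by positivity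
  -- The summand added to `C` only serves to make `c_l < c_u` strict.
  refine ⟨(Real.sqrt c₂)⁻¹, C + (Real.sqrt c₂)⁻¹, hcl, by linarith, fun f hf => ?_⟩
  obtain ⟨hfm, hf0⟩ := hf
  choose φ hφ hφf using fun n : ℕ => hf0 (1 / ((n : ℝ) + 1)) (by positivity)
  choose u hu hun using fun n => hCφ (φ n) (hφ n)
  have hS : ∀ n, sobolevSeminorm Ω m (f - φ n) ≤ 1 / ((n : ℝ) + 1) := fun n =>
    (sobolevSeminorm_le_sobolevNorm le_rfl _).trans (hφf n).le
  have hS' : ∀ n, sobolevSeminorm Ω m (φ n - f) ≤ 1 / ((n : ℝ) + 1) := fun n => by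
    rw [((hφ n).memSobolev m).sobolevSeminorm_sub_comm hΩ hfm]
    exact hS n
  have hlim0 : Tendsto (fun n : ℕ => 1 / ((n : ℝ) + 1)) atTop (𝓝 0) :=
    tendsto_one_div_add_atTop_nhds_zero_nat
  have hSlim : Tendsto (fun n => sobolevSeminorm Ω m (φ n)) atTop
      (𝓝 (sobolevSeminorm Ω m f)) := by
    refine tendsto_of_tendsto_of_dist tendsto_const_nhds (squeeze_zero (fun _ => dist_nonneg)
      (fun n => ?_) hlim0)
    rw [Real.dist_eq, abs_le]
    have h1 := hfm.sobolevSeminorm_le hΩ ((hφ n).memSobolev m)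
    have h2 := ((hφ n).memSobolev m).sobolevSeminorm_le hΩ hfm
    constructor <;> linarith [hS n, hS' n]
  have hdist : ∀ n p, ‖u n - u p‖ ≤ C * (1 / ((n : ℝ) + 1) + 1 / ((p : ℝ) + 1)) := by
    intro n p
    have hsub := (hφ n).sub (hφ p)
    obtain ⟨w, hw, hwn⟩ := hCφ _ hsub
    -- Elements of the Hilbert space are determined by their values, so the norm bound for the test
    -- function `φ n - φ p` applies to `u n - u p`.
    have hwu : w = u n - u p := RKHS.ext fun x => by
      rw [hw, RKHS.coe_sub, Pi.sub_apply, hu, hu]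
    rw [← hwu]
    refine hwn.trans ?_
    rw [← hsub.sobolevSeminorm_eq hΩ]
    gcongr
    have h1 := (hsub.memSobolev m).sobolevSeminorm_le hΩ (((hφ n).memSobolev m).sub hfm)
    have h2 : (fun x => φ n x - φ p x) - (φ n - f) = f - φ p := by
      funext x; simp
    rw [h2] at h1
    linarith [hS p, hS' n]
  have hcauchy : CauchySeq u := by
    refine cauchySeq_of_le_tendsto_0 (fun N : ℕ => C * (1 / ((N : ℝ) + 1) + 1 / ((N : ℝ) + 1)))
      (fun n p N hn hp => ?_) ?_
    · rw [dist_eq_norm]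
      refine (hdist n p).trans ?_
      gcongr
    · simpa using (hlim0.add hlim0).const_mul C
  obtain ⟨h, hh⟩ := cauchySeq_tendsto_of_complete hcauchy
  -- Kernel sections have uniformly bounded norm, so norm convergence is uniform on `Ω` and the
  -- limit inherits continuity from the `φ n`.
  have hunif : TendstoUniformly (fun n => ⇑(u n)) (⇑h) atTop :=
    RKHS.tendstoUniformly_of_norm_kerFun_le (norm_kerFun_translationKernel_le κ) hh
  have hucoe : ∀ n, ⇑(u n) = fun x : Ω => φ n x := fun n => funext (hu n)
  refine ⟨h, ?_, ?_, ?_, ?_⟩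
  · refine hunif.continuous (Frequently.of_forall fun n => ?_)
    rw [hucoe]
    exact (hφ n).continuous.comp continuous_subtype_val
  -- The order-zero part of the Sobolev norm gives convergence to `f` in `L²`, hence almost
  -- everywhere along a subsequence; the uniform limit must agree with `f` there.
  · have hL2 : Tendsto (fun n => eLpNorm (φ n - f) 2 (volume.restrict Ω)) atTop (𝓝 0) := by
      have hle : ∀ n, eLpNorm (φ n - f) 2 (volume.restrict Ω)
          ≤ ENNReal.ofReal (1 / ((n : ℝ) + 1)) := by
        intro n
        have hm := hfm.sub ((hφ n).memSobolev m)
        rw [eLpNorm_sub_comm, hm.1.eLpNorm_eq_integral_rpow_norm two_ne_zero ENNReal.ofNat_ne_top]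
        refine ENNReal.ofReal_le_ofReal ?_
        have h1 := (sobolevSeminorm_le_sobolevNorm (Nat.zero_le m) (f - φ n)).trans (hφf n).le
        rw [hm.sobolevSeminorm_zero hΩ, Real.sqrt_eq_rpow] at h1
        simpa using h1
      refine tendsto_of_tendsto_of_tendsto_of_le_of_le tendsto_const_nhds ?_
        (fun _ => zero_le) hle
      simpa [Function.comp_def] using (ENNReal.continuous_ofReal.tendsto 0).comp hlim0
    obtain ⟨ns, hns, hae⟩ := (tendstoInMeasure_of_tendsto_eLpNorm two_ne_zero
      (fun n => ((hφ n).memSobolev m).1.aestronglyMeasurable)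
      hfm.1.aestronglyMeasurable hL2).exists_seq_tendsto_ae
    filter_upwards [(ae_restrict_iff' hΩ.measurableSet).1 hae] with x hx hxΩ
    have h1 := (hunif.tendsto_at ⟨x, hxΩ⟩).comp hns.tendsto_atTop
    simp only [hucoe] at h1
    exact tendsto_nhds_unique h1 (hx hxΩ)
  · refine le_of_tendsto_of_tendsto (hSlim.const_mul _) hh.norm (.of_forall fun n => ?_)
    simp only
    rw [inv_mul_le_iff₀ (by positivity), (hφ n).sobolevSeminorm_eq hΩ,
      ← Real.sqrt_sq (norm_nonneg (u n)), ← Real.sqrt_mul hc₂.le]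
    exact Real.sqrt_le_sqrt (hκ.integral_symbol_mul_le (hφ n) (u n) (hu n))
  · refine le_of_tendsto_of_tendsto hh.norm (hSlim.const_mul _) (.of_forall fun n => ?_)
    simp only
    refine (hun n).trans ?_
    rw [← (hφ n).sobolevSeminorm_eq hΩ]
    have : 0 ≤ sobolevSeminorm Ω m (φ n) := Real.sqrt_nonneg _
    gcongr
    linarith
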